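/- Work in the two-sorted language of second-order arithmetic $(0,1,+,\cdot,<,\in)$. Let $\mathsf{RCA}_0$ be the theory consisting of the basic axioms for $0,1,+,\cdot,<$, the induction scheme for $\Sigma^0_1$ formulas and the comprehension scheme for $\Delta^0_1$ predicates (number and set parameters allowed), and let $\mathsf{ACA}_0$ be $\mathsf{RCA}_0$ together with comprehension for all arithmetical formulas. Fix a primitive recursive presentation of the ordered set $(\mathbb{Q},<_{\mathbb{Q}})$ of rationals: a rational is represented by the least code $((m,n),k)$ of a fraction $(m-n)/(k+1)$ of its value, with $m,n,k\in\mathbb{N}$ and $(i,j)=(i+j)^2+i$. Let $\mathsf{ER}^2_2$ be the following sentence of second-order arithmetic: for every coloring $f\colon[\mathbb{Q}]^2\to 2$ of the two-element sets of rationals there is either an infinite set $H\subseteq\mathbb{Q}$ that is $0$-homogeneous (i.e. $f(x,y)=0$ for all distinct $x,y\in H$), or a $1$-homogeneous set $H\subseteq\mathbb{Q}$ such that $(H,\leq_{\mathbb{Q}})$ is a dense linear order (i.e. $H$ has at least two elements, and between any two elements $x<_{\mathbb{Q}}y$ of $H$ there is a $z\in H$ with $x<_{\mathbb{Q}}z<_{\mathbb{Q}}y$).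 **Theorem.** $\mathsf{ER}^2_2$ is provable in $\mathsf{ACA}_0$. -/

import Mathlib

/-! Two-sorted first-order logic in the language of second-order arithmetic, the theories
`RCA₀` and `ACA₀`, and the Erdős–Rado statement for pairs of rationals.
Bound variables are de Bruijn indices, counted separately for the number sort and the set sort. -/

namespace SOA

/-- Numerical terms over `0, 1, +, ·`; `var n` is the `n`-th number variable. -/
inductive Tm : Type
  | var : ℕ → Tm
  | zero : Tm
  | one : Tm
  | add : Tm → Tm → Tm
  | mul : Tm → Tm → Tm

/-- Formulas of second-order arithmetic. `mem t X` is `t ∈ X` for the `X`-th set variable;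
`all` binds number variable `0`, `allS` binds set variable `0`. -/
inductive Fm : Type
  | eq : Tm → Tm → Fm
  | lt : Tm → Tm → Fm
  | mem : Tm → ℕ → Fm
  | falsum : Fm
  | imp : Fm → Fm → Fm
  | all : Fm → Fm
  | allS : Fm → Fm

/-! ### Substitution -/

/-- Simultaneous substitution of terms for number variables. -/
def Tm.subst (σ : ℕ → Tm) : Tm → Tm
  | .var n => σ n
  | .zero => .zero
  | .one => .one
  | .add s t => .add (s.subst σ) (t.subst σ)
  | .mul s t => .mul (s.subst σ) (t.subst σ)

/-- Raise every variable of `t` by `k`, so that `t` can be used below `k` more number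
quantifiers. -/
def Tm.lift (k : ℕ) (t : Tm) : Tm := t.subst fun n => .var (n + k)

/-- `t, σ 0, σ 1, …` -/
def scons {α : Type} (t : α) (σ : ℕ → α) : ℕ → α
  | 0 => t
  | n + 1 => σ n

/-- Simultaneous substitution of terms for number variables and of set variables for set
variables. -/
def Fm.subst : (ℕ → Tm) → (ℕ → ℕ) → Fm → Fm
  | σ, _, .eq s t => .eq (s.subst σ) (t.subst σ)
  | σ, _, .lt s t => .lt (s.subst σ) (t.subst σ)
  | σ, ρ, .mem t X => .mem (t.subst σ) (ρ X)
  | _, _, .falsum => .falsum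
  | σ, ρ, .imp φ ψ => .imp (φ.subst σ ρ) (ψ.subst σ ρ)
  | σ, ρ, .all φ => .all (φ.subst (scons (.var 0) fun n => (σ n).lift 1) ρ)
  | σ, ρ, .allS φ => .allS (φ.subst σ (scons 0 fun n => ρ n + 1))

/-- Weakening of `φ` by a fresh number variable `0`. -/
def Fm.shift (φ : Fm) : Fm := φ.subst (fun n => .var (n + 1)) id

/-- Weakening of `φ` by a fresh set variable `0`. -/
def Fm.shiftS (φ : Fm) : Fm := φ.subst .var (· + 1)

/-- `φ[t/0]`, for the matrix `φ` of a number quantifier. -/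
def Fm.inst (φ : Fm) (t : Tm) : Fm := φ.subst (scons t .var) id

/-- `φ[X/0]`, for the matrix `φ` of a set quantifier. -/
def Fm.instS (φ : Fm) (X : ℕ) : Fm := φ.subst .var (scons X id)

/-! ### Defined connectives and quantifiers (classical logic) -/

def Fm.neg (φ : Fm) : Fm := φ.imp .falsum
def Fm.or (φ ψ : Fm) : Fm := φ.neg.imp ψ
def Fm.and (φ ψ : Fm) : Fm := (φ.imp ψ.neg).neg
def Fm.iff (φ ψ : Fm) : Fm := (φ.imp ψ).and (ψ.imp φ)
def Fm.ex (φ : Fm) : Fm := (Fm.all φ.neg).neg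
def Fm.exS (φ : Fm) : Fm := (Fm.allS φ.neg).neg

/-- `∀ x < t, φ` and `∃ x < t, φ`; the bound `t` is not in the scope of the quantifier. -/
def Fm.ball (t : Tm) (φ : Fm) : Fm := .all ((Fm.lt (.var 0) (t.lift 1)).imp φ)
def Fm.bex (t : Tm) (φ : Fm) : Fm := .ex ((Fm.lt (.var 0) (t.lift 1)).and φ)

/-! ### Provability -/

/-- Natural deduction for classical two-sorted logic with equality on the number sort.
`Derivable T Γ φ`: `φ` is derivable from the open hypotheses `Γ` and the nonlogical axioms `T`,
where every axiom in `T` stands for its universal closure. -/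
inductive Derivable (T : Set Fm) : List Fm → Fm → Prop
  | axm {Γ φ} : φ ∈ T → Derivable T Γ φ
  | hyp {Γ φ} : φ ∈ Γ → Derivable T Γ φ
  | impI {Γ φ ψ} : Derivable T (φ :: Γ) ψ → Derivable T Γ (φ.imp ψ)
  | impE {Γ φ ψ} : Derivable T Γ (φ.imp ψ) → Derivable T Γ φ → Derivable T Γ ψ
  | raa {Γ φ} : Derivable T (φ.neg :: Γ) .falsum → Derivable T Γ φ
  | allI {Γ φ} : Derivable T (Γ.map Fm.shift) φ → Derivable T Γ (.all φ)
  | allE {Γ φ} (t : Tm) : Derivable T Γ (.all φ) → Derivable T Γ (φ.inst t)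
  | allSI {Γ φ} : Derivable T (Γ.map Fm.shiftS) φ → Derivable T Γ (.allS φ)
  | allSE {Γ φ} (X : ℕ) : Derivable T Γ (.allS φ) → Derivable T Γ (φ.instS X)
  | eqRefl {Γ} (t : Tm) : Derivable T Γ (.eq t t)
  | eqSubst {Γ} (φ : Fm) {s t : Tm} :
      Derivable T Γ (.eq s t) → Derivable T Γ (φ.inst s) → Derivable T Γ (φ.inst t)

/-- `φ` is provable in the theory with axioms `T`. -/
def Proves (T : Set Fm) (φ : Fm) : Prop := Derivable T [] φ

/-! ### Formula classes -/

/-- Formulas with bounded number quantifiers only (and arbitrary set parameters). -/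
inductive IsBounded : Fm → Prop
  | eq (s t : Tm) : IsBounded (.eq s t)
  | lt (s t : Tm) : IsBounded (.lt s t)
  | mem (t : Tm) (X : ℕ) : IsBounded (.mem t X)
  | falsum : IsBounded .falsum
  | imp {φ ψ : Fm} : IsBounded φ → IsBounded ψ → IsBounded (φ.imp ψ)
  | ball (t : Tm) {φ : Fm} : IsBounded φ → IsBounded (φ.ball t)

/-- `∃ n, θ` with `θ` bounded. -/
def IsSigma1 (φ : Fm) : Prop := ∃ θ, IsBounded θ ∧ φ = .ex θ

/-- `∀ n, θ` with `θ` bounded. -/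
def IsPi1 (φ : Fm) : Prop := ∃ θ, IsBounded θ ∧ φ = .all θ

/-- No set quantifiers; set parameters are allowed. -/
def IsArithmetical : Fm → Prop
  | .imp φ ψ => IsArithmetical φ ∧ IsArithmetical ψ
  | .all φ => IsArithmetical φ
  | .allS _ => False
  | _ => True

/-! ### The theories -/

/-- `∃ X ∀ n, (n ∈ X ↔ φ(n))`, where `n` is number variable `0` of `φ`, all other variables of
`φ` are parameters, and `X` does not occur in `φ`. -/
def comprehension (φ : Fm) : Fm := .exS (.all ((Fm.mem (.var 0) 0).iff φ.shiftS))

/-- `φ(0) ∧ ∀ n, (φ(n) → φ(n + 1)) → ∀ n, φ(n)`, where `n` is number variable `0` of `φ`. -/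
def induction (φ : Fm) : Fm :=
  ((φ.inst .zero).and
    (.all (φ.imp (φ.subst (scons (.add (.var 0) .one) fun n => .var (n + 1)) id)))).imp (.all φ)

/-- The basic axioms for `0, 1, +, ·, <`. -/
def basicAxioms : Set Fm :=
  let n := Tm.var 0
  let m := Tm.var 1
  { .all (Fm.eq (.add n .one) .zero).neg,
    .all (.all ((Fm.eq (.add m .one) (.add n .one)).imp (.eq m n))),
    .all (.eq (.add n .zero) n),
    .all (.all (.eq (.add m (.add n .one)) (.add (.add m n) .one))),
    .all (.eq (.mul n .zero) .zero),
    .all (.all (.eq (.mul m (.add n .one)) (.add (.mul m n) m))),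
    .all (Fm.lt n .zero).neg,
    .all (.all ((Fm.lt m (.add n .one)).iff ((Fm.lt m n).or (.eq m n)))) }

/-- `RCA₀`: basic axioms, `Σ⁰₁`-induction and `Δ⁰₁`-comprehension. -/
def RCA0 : Set Fm :=
  basicAxioms ∪
  {χ | ∃ φ, IsSigma1 φ ∧ χ = induction φ} ∪
  {χ | ∃ φ ψ, IsSigma1 φ ∧ IsPi1 ψ ∧ χ = (Fm.all (φ.iff ψ)).imp (comprehension φ)}

/-- `ACA₀`: `RCA₀` with arithmetical comprehension. -/
def ACA0 : Set Fm := RCA0 ∪ {χ | ∃ φ, IsArithmetical φ ∧ χ = comprehension φ}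

/-! ### The rationals in second-order arithmetic -/

/-- The code `(s + t)² + s` of the ordered pair `(s, t)`. -/
def pair (s t : Tm) : Tm := .add (.mul (.add s t) (.add s t)) s

/-- The code of the fraction `(m - n) / (k + 1)`. -/
def frac (m n k : Tm) : Tm := pair (pair m n) k

/-- `m (k' + 1) + n' (k + 1)`, the left-hand side when `(m - n) / (k + 1)` and
`(m' - n') / (k' + 1)` are compared by cross-multiplication. -/
def cross (m k n' k' : Tm) : Tm := .add (.mul m (.add k' .one)) (.mul n' (.add k .one))

/-- `(m - n) / (k + 1) = (m' - n') / (k' + 1)` -/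
def fracEq (m n k m' n' k' : Tm) : Fm := .eq (cross m k n' k') (cross m' k' n k)

/-- `(m - n) / (k + 1) < (m' - n') / (k' + 1)` -/
def fracLt (m n k m' n' k' : Tm) : Fm := .lt (cross m k n' k') (cross m' k' n k)

/-- `q ∈ ℚ`: `q` is the code of a fraction, and it is the least code of a fraction of its value.
`∃ m n k ≤ q, q = frac m n k ∧ ∀ m' n' k' ≤ q, m'n'k' equal to mnk → ¬ frac m' n' k' < q`. -/
def isRat (q : Tm) : Fm :=
  let b (i : ℕ) : Tm := .add (q.lift i) .one
  .bex (b 0) <| .bex (b 1) <| .bex (b 2) <|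
    (Fm.eq (q.lift 3) (frac (.var 2) (.var 1) (.var 0))).and <|
    .ball (b 3) <| .ball (b 4) <| .ball (b 5) <|
      (fracEq (.var 5) (.var 4) (.var 3) (.var 2) (.var 1) (.var 0)).imp
        (Fm.lt (frac (.var 2) (.var 1) (.var 0)) (q.lift 6)).neg

/-- `p <_ℚ q`, for (codes of) rationals `p, q`:
`∃ m n k ≤ p, ∃ m' n' k' ≤ q, p = frac m n k ∧ q = frac m' n' k' ∧ mnk smaller than m'n'k'`. -/
def ratLt (p q : Tm) : Fm :=
  let a (i : ℕ) : Tm := .add (p.lift i) .one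
  let b (i : ℕ) : Tm := .add (q.lift i) .one
  .bex (a 0) <| .bex (a 1) <| .bex (a 2) <| .bex (b 3) <| .bex (b 4) <| .bex (b 5) <|
    (Fm.eq (p.lift 6) (frac (.var 5) (.var 4) (.var 3))).and <|
    (Fm.eq (q.lift 6) (frac (.var 2) (.var 1) (.var 0))).and <|
    fracLt (.var 5) (.var 4) (.var 3) (.var 2) (.var 1) (.var 0)

/-! ### The Erdős–Rado statement -/

/-- `t < 2` -/
def isColor (t : Tm) : Fm := .lt t (.add .one .one)

/-- `{x, y} ∈ [ℚ]²`, a two-element set being given by its elements `x < y` in the order of `ℕ`. -/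
def isRatPair (x y : Tm) : Fm := (isRat x).and ((isRat y).and (.lt x y))

/-- `F` is (the graph of) a function `[ℚ]² → 2`: a set of codes `((x, y), i)` with
`{x, y} ∈ [ℚ]²` and `i < 2`, which has exactly one such `i` for each `{x, y} ∈ [ℚ]²`. -/
def isColoring (F : ℕ) : Fm :=
  -- every `z ∈ F` is some `((x, y), i)`
  (Fm.all <| (Fm.mem (.var 0) F).imp <| .ex <| .ex <| .ex <|
    (isRatPair (.var 2) (.var 1)).and <| (isColor (.var 0)).and <|
      .eq (.var 3) (pair (pair (.var 2) (.var 1)) (.var 0))).and <|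
  -- for all `x, y` there is exactly one `i`
  .all <| .all <| (isRatPair (.var 1) (.var 0)).imp <|
    .ex <| (isColor (.var 0)).and <| (Fm.mem (pair (pair (.var 2) (.var 1)) (.var 0)) F).and <|
      .all <| (Fm.mem (pair (pair (.var 3) (.var 2)) (.var 0)) F).imp <|
        .eq (.var 0) (.var 1)

/-- `H ⊆ ℚ` -/
def subRat (H : ℕ) : Fm := .all <| (Fm.mem (.var 0) H).imp (isRat (.var 0))

/-- `H ⊆ ℚ` and `F(x, y) = i` for all `{x, y} ∈ [H]²`. -/
def isHomogeneous (F : ℕ) (i : Tm) (H : ℕ) : Fm :=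
  (subRat H).and <| .all <| .all <|
    (Fm.mem (.var 1) H).imp <| (Fm.mem (.var 0) H).imp <| (Fm.lt (.var 1) (.var 0)).imp <|
      .mem (pair (pair (.var 1) (.var 0)) (i.lift 2)) F

/-- `H` is infinite: `∀ n, ∃ x ∈ H, n < x`. -/
def isInfinite (H : ℕ) : Fm :=
  .all <| .ex <| (Fm.mem (.var 0) H).and (.lt (.var 1) (.var 0))

/-- `(H, ≤_ℚ)` is a dense linear order. It has at least two elements, and strictly between any two
elements of `H` there is another one:
`(∃ x ∈ H, ∃ y ∈ H, x <_ℚ y) ∧ ∀ x ∈ H, ∀ y ∈ H, x <_ℚ y → ∃ z ∈ H, x <_ℚ z ∧ z <_ℚ y`. -/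
def isDense (H : ℕ) : Fm :=
  (Fm.ex <| .ex <| (Fm.mem (.var 1) H).and <| (Fm.mem (.var 0) H).and <|
    ratLt (.var 1) (.var 0)).and <|
  .all <| .all <| (Fm.mem (.var 1) H).imp <| (Fm.mem (.var 0) H).imp <|
    (ratLt (.var 1) (.var 0)).imp <|
      .ex <| (Fm.mem (.var 0) H).and <|
        (ratLt (.var 2) (.var 0)).and (ratLt (.var 0) (.var 1))

/-- For every coloring `F : [ℚ]² → 2` there is an infinite `0`-homogeneous set or a
`1`-homogeneous set `H` such that `(H, ≤_ℚ)` is dense. -/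
def ER22 : Fm :=
  .allS <| (isColoring 0).imp <|
    (Fm.exS <| (isHomogeneous 1 .zero 0).and (isInfinite 0)).or
    (Fm.exS <| (isHomogeneous 1 .one 0).and (isDense 0))

end SOA

/-!
By the completeness theorem it suffices to show that the sentence `ER22` holds in every model of
`ACA₀`, and this is checked by a direct construction.

*Completeness* (`SOA.proves_of_forall_sat`). Variables serve as Henkin constants: a finite
consistent list of formulas always leaves a variable fresh (`SOA.Derivable.exists_fresh`), so it
extends to a complete theory in which each refuted universal formula is refuted by a variable
(`SOA.exists_isHenkin`). Terms modulo provable equality, together with the extensions of the set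
variables, form a model of that theory (`SOA.IsHenkin.sat_iff`).

*The argument in a model.* Definability in a model `M` of `ACA₀` is tracked by the class `SOA.Ar`,
whose instances follow the syntax of formulas, so that comprehension (`SOA.isSet_setOf`) and
induction (`SOA.induct`) can be applied to predicates written in Lean. Finite sets are coded by
numbers through divisibility by the pairwise coprime moduli `1 + (i + 1) b` (`SOA.exists_code`).
Hence a sequence of extensions of finite sets, chosen arithmetically one after the other, has a
union that is a set of the model (`SOA.exists_union`).

For a finite set `w` let `Red w` be the set of rationals that form a pair of color `0` with every
element of `w`. Suppose first that, whenever `Red w` is dense in an interval, it contains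
arbitrarily large `x` such that `Red (w ∪ {x})` is dense in a subinterval. Adding such elements
again and again yields an infinite `0`-homogeneous set (`SOA.exists_infinite_of_extend`). Otherwise
some `X = Red w` is dense in an interval `I`, while for all but finitely many `x ∈ X ∩ I` the
elements of `X` that form a pair of color `0` with `x` are nowhere dense in `I`. Since finite unions
of nowhere dense sets are nowhere dense (`SOA.exists_subI_avoiding`), every subinterval of `I`
contains an element of `X` that forms no pair of color `0` with finitely many given ones, and a
dense `1`-homogeneous set is built by visiting all subintervals in turn
(`SOA.exists_dense_of_nowhere_dense`).
-/

namespace SOA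

/-! ### Substitution calculus -/

theorem Tm.subst_subst (t : Tm) (σ τ : ℕ → Tm) :
    (t.subst σ).subst τ = t.subst fun n => (σ n).subst τ := by
  induction t <;> simp_all [Tm.subst]

@[simp] theorem Tm.subst_var (t : Tm) : t.subst .var = t := by
  induction t <;> simp_all [Tm.subst]

/-- The substitution used below a number quantifier. -/
def up (σ : ℕ → Tm) : ℕ → Tm := scons (.var 0) fun n => (σ n).lift 1

/-- The renaming used below a set quantifier. -/
def upS (ρ : ℕ → ℕ) : ℕ → ℕ := scons 0 fun n => ρ n + 1

theorem up_var : up .var = .var := by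
  funext n; cases n <;> rfl

theorem upS_id : upS id = id := by
  funext n; cases n <;> rfl

theorem up_subst_up (σ τ : ℕ → Tm) :
    (fun n => (up σ n).subst (up τ)) = up fun n => (σ n).subst τ := by
  funext n
  cases n with
  | zero => rfl
  | succ n => simp only [up, scons, Tm.lift, Tm.subst_subst]; rfl

theorem upS_comp (ρ π : ℕ → ℕ) : upS π ∘ upS ρ = upS (π ∘ ρ) := by
  funext n; cases n <;> rfl

theorem Fm.subst_subst (φ : Fm) (σ τ : ℕ → Tm) (ρ π : ℕ → ℕ) :
    (φ.subst σ ρ).subst τ π = φ.subst (fun n => (σ n).subst τ) (π ∘ ρ) := by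
  induction φ generalizing σ τ ρ π with
  | eq | lt | mem => simp [Fm.subst, Tm.subst_subst]
  | falsum => rfl
  | imp _ _ ih₁ ih₂ => simp [Fm.subst, ih₁, ih₂]
  | all _ ih =>
    simp only [Fm.subst, ih]
    exact congrArg (fun σ => Fm.all (Fm.subst σ _ _)) (up_subst_up σ τ)
  | allS _ ih =>
    simp only [Fm.subst, ih]
    exact congrArg (fun ρ => Fm.allS (Fm.subst _ ρ _)) (upS_comp ρ π)

@[simp] theorem Fm.subst_var (φ : Fm) : φ.subst .var id = φ := by
  induction φ with
  | eq | lt | mem => simp [Fm.subst]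
  | falsum => rfl
  | imp _ _ ih₁ ih₂ => simp [Fm.subst, ih₁, ih₂]
  | all φ ih => exact congrArg Fm.all ((congrArg (Fm.subst · id φ) up_var).trans ih)
  | allS φ ih => exact congrArg Fm.allS ((congrArg (Fm.subst .var · φ) upS_id).trans ih)

theorem Tm.lift_subst_scons (s t : Tm) : (s.lift 1).subst (scons t .var) = s := by
  rw [Tm.lift, Tm.subst_subst]
  exact Tm.subst_var _

theorem Fm.subst_all (φ : Fm) (σ : ℕ → Tm) (ρ : ℕ → ℕ) :
    (Fm.all φ).subst σ ρ = .all (φ.subst (up σ) ρ) := rfl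

theorem Fm.subst_allS (φ : Fm) (σ : ℕ → Tm) (ρ : ℕ → ℕ) :
    (Fm.allS φ).subst σ ρ = .allS (φ.subst σ (upS ρ)) := rfl

theorem Fm.subst_up_inst (φ : Fm) (σ : ℕ → Tm) (ρ : ℕ → ℕ) (t : Tm) :
    (φ.subst (up σ) ρ).inst t = φ.subst (scons t σ) ρ := by
  rw [Fm.inst, Fm.subst_subst]
  congr 1
  funext n
  cases n with
  | zero => rfl
  | succ n => simp only [up, scons, Tm.lift, Tm.subst_subst]; exact Tm.subst_var _

theorem Fm.subst_upS_instS (φ : Fm) (σ : ℕ → Tm) (ρ : ℕ → ℕ) (X : ℕ) :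
    (φ.subst σ (upS ρ)).instS X = φ.subst σ (scons X ρ) := by
  rw [Fm.instS, Fm.subst_subst]
  congr 1
  · funext n; exact Tm.subst_var _
  · funext n; cases n <;> rfl

theorem Fm.inst_subst (φ : Fm) (σ : ℕ → Tm) (ρ : ℕ → ℕ) (t : Tm) :
    (φ.inst t).subst σ ρ = (φ.subst (up σ) ρ).inst (t.subst σ) := by
  rw [Fm.subst_up_inst, Fm.inst, Fm.subst_subst]
  congr 1
  funext n; cases n <;> rfl

theorem Fm.instS_subst (φ : Fm) (σ : ℕ → Tm) (ρ : ℕ → ℕ) (X : ℕ) :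
    (φ.instS X).subst σ ρ = (φ.subst σ (upS ρ)).instS (ρ X) := by
  rw [Fm.subst_upS_instS, Fm.instS, Fm.subst_subst]
  congr 1
  funext n; cases n <;> rfl

theorem Fm.shift_subst_up (φ : Fm) (σ : ℕ → Tm) (ρ : ℕ → ℕ) :
    φ.shift.subst (up σ) ρ = (φ.subst σ ρ).shift := by
  simp only [Fm.shift, Fm.subst_subst]
  rfl

theorem Fm.shiftS_subst_upS (φ : Fm) (σ : ℕ → Tm) (ρ : ℕ → ℕ) :
    φ.shiftS.subst σ (upS ρ) = (φ.subst σ ρ).shiftS := by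
  simp only [Fm.shiftS, Fm.subst_subst]
  congr 1
  funext n; exact (Tm.subst_var _).symm

theorem Tm.exists_subst_congr (t : Tm) :
    ∃ N, ∀ σ τ : ℕ → Tm, (∀ n < N, σ n = τ n) → t.subst σ = t.subst τ := by
  induction t with
  | var n => exact ⟨n + 1, fun σ τ h => h n n.lt_succ_self⟩
  | zero | one => exact ⟨0, fun _ _ _ => rfl⟩
  | add s t hs ht | mul s t hs ht =>
    obtain ⟨a, ha⟩ := hs
    obtain ⟨b, hb⟩ := ht
    refine ⟨max a b, fun σ τ h => ?_⟩
    simp only [Tm.subst]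
    rw [ha σ τ fun n hn => h n (by omega), hb σ τ fun n hn => h n (by omega)]

/-- A formula has finitely many free variables; `N` bounds all of them. -/
theorem Fm.exists_subst_congr (φ : Fm) :
    ∃ N, ∀ (σ τ : ℕ → Tm) (ρ π : ℕ → ℕ), (∀ n < N, σ n = τ n) → (∀ n < N, ρ n = π n) →
      φ.subst σ ρ = φ.subst τ π := by
  induction φ with
  | eq s t | lt s t =>
    obtain ⟨a, ha⟩ := s.exists_subst_congr
    obtain ⟨b, hb⟩ := t.exists_subst_congr
    refine ⟨max a b, fun σ τ ρ π h _ => ?_⟩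
    simp only [Fm.subst]
    rw [ha σ τ fun n hn => h n (by omega), hb σ τ fun n hn => h n (by omega)]
  | mem t X =>
    obtain ⟨a, ha⟩ := t.exists_subst_congr
    refine ⟨max a (X + 1), fun σ τ ρ π h h' => ?_⟩
    simp only [Fm.subst]
    rw [ha σ τ fun n hn => h n (by omega), h' X (by omega)]
  | falsum => exact ⟨0, fun _ _ _ _ _ _ => rfl⟩
  | imp φ ψ h₁ h₂ =>
    obtain ⟨a, ha⟩ := h₁
    obtain ⟨b, hb⟩ := h₂
    refine ⟨max a b, fun σ τ ρ π h h' => ?_⟩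
    simp only [Fm.subst]
    rw [ha σ τ ρ π (fun n hn => h n (by omega)) fun n hn => h' n (by omega),
      hb σ τ ρ π (fun n hn => h n (by omega)) fun n hn => h' n (by omega)]
  | all φ ih =>
    obtain ⟨a, ha⟩ := ih
    refine ⟨a, fun σ τ ρ π h h' => ?_⟩
    rw [Fm.subst_all, Fm.subst_all, ha (up σ) (up τ) ρ π _ h']
    rintro (_ | n) hn
    · rfl
    · simp only [up, scons, h n (by omega)]
  | allS φ ih =>
    obtain ⟨a, ha⟩ := ih
    refine ⟨a, fun σ τ ρ π h h' => ?_⟩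
    rw [Fm.subst_allS, Fm.subst_allS, ha σ τ (upS ρ) (upS π) h]
    rintro (_ | n) hn
    · rfl
    · simp only [upS, scons, h' n (by omega)]

/-! ### Structural properties of derivability -/

namespace Derivable

variable {T : Set Fm} {Γ Δ : List Fm} {φ ψ : Fm}

theorem weaken (h : Derivable T Γ φ) (hΓ : Γ ⊆ Δ) : Derivable T Δ φ := by
  induction h generalizing Δ with
  | axm h => exact .axm h
  | hyp h => exact .hyp (hΓ h)
  | impI _ ih => exact .impI (ih (List.cons_subset_cons _ hΓ))
  | impE _ _ ih₁ ih₂ => exact .impE (ih₁ hΓ) (ih₂ hΓ)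
  | raa _ ih => exact .raa (ih (List.cons_subset_cons _ hΓ))
  | allI _ ih => exact .allI (ih (List.map_subset _ hΓ))
  | allE t _ ih => exact .allE t (ih hΓ)
  | allSI _ ih => exact .allSI (ih (List.map_subset _ hΓ))
  | allSE X _ ih => exact .allSE X (ih hΓ)
  | eqRefl t => exact .eqRefl t
  | eqSubst φ _ _ ih₁ ih₂ => exact .eqSubst φ (ih₁ hΓ) (ih₂ hΓ)

/-- The sequence that starts with the given list and continues with `v`. -/
def listSubst {α : Type} (v : ℕ → α) : List α → ℕ → α
  | [] => v
  | t :: l => scons t (listSubst v l)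

theorem listSubst_ofFn {α : Type} (v σ : ℕ → α) (N : ℕ) :
    ∀ n < N, listSubst v (List.ofFn fun i : Fin N => σ i) n = σ n := by
  induction N generalizing σ with
  | zero => intro n hn; omega
  | succ N ih =>
    rintro (_ | n) hn <;> rw [List.ofFn_succ]
    · rfl
    · exact ih (fun n => σ (n + 1)) n (by omega)

/-- Nonlogical axioms stand for their universal closures. -/
theorem axm_subst (h : φ ∈ T) (σ : ℕ → Tm) (ρ : ℕ → ℕ) : Derivable T Γ (φ.subst σ ρ) := by
  have h₁ : ∀ (l : List Tm) (ψ : Fm), (∀ Γ, Derivable T Γ ψ) →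
      ∀ Γ, Derivable T Γ (ψ.subst (listSubst .var l) id) := by
    intro l
    induction l with
    | nil => intro ψ hψ Γ; simpa [listSubst] using hψ Γ
    | cons t l ih =>
      intro ψ hψ Γ
      have : Derivable T Γ ((ψ.subst (up (listSubst .var l)) id).inst t) :=
        (ih _ (fun Γ => .allI (hψ (Γ.map Fm.shift))) Γ).allE t
      rwa [Fm.subst_up_inst] at this
  have h₂ : ∀ (l : List ℕ) (ψ : Fm), (∀ Γ, Derivable T Γ ψ) →
      ∀ Γ, Derivable T Γ (ψ.subst .var (listSubst id l)) := by
    intro l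
    induction l with
    | nil => intro ψ hψ Γ; simpa [listSubst] using hψ Γ
    | cons t l ih =>
      intro ψ hψ Γ
      have : Derivable T Γ ((ψ.subst .var (upS (listSubst id l))).instS t) :=
        (ih _ (fun Γ => .allSI (hψ (Γ.map Fm.shiftS))) Γ).allSE t
      rwa [Fm.subst_upS_instS] at this
  obtain ⟨N, hN⟩ := φ.exists_subst_congr
  have := h₂ (List.ofFn fun i : Fin N => ρ i) _
    (h₁ (List.ofFn fun i : Fin N => σ i) φ fun Γ => .axm h) Γ
  rw [Fm.subst_subst] at this
  have hσ : ∀ n < N,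
      (listSubst .var (List.ofFn fun i : Fin N => σ i) n).subst .var = σ n := fun n hn => by
    rw [Tm.subst_var, listSubst_ofFn _ _ _ n hn]
  rwa [Function.comp_id, hN _ σ _ ρ hσ (listSubst_ofFn id ρ N)] at this

theorem subst (h : Derivable T Γ φ) (σ : ℕ → Tm) (ρ : ℕ → ℕ) :
    Derivable T (Γ.map (Fm.subst σ ρ)) (φ.subst σ ρ) := by
  induction h generalizing σ ρ with
  | axm h => exact axm_subst h σ ρ
  | hyp h => exact .hyp (List.mem_map_of_mem h)
  | impI _ ih => exact .impI (ih σ ρ)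
  | impE _ _ ih₁ ih₂ => exact .impE (ih₁ σ ρ) (ih₂ σ ρ)
  | raa _ ih => exact .raa (ih σ ρ)
  | allI _ ih =>
    refine .allI ?_
    change Derivable T _ (Fm.subst (up σ) ρ _)
    have := ih (up σ) ρ
    rw [List.map_map] at this ⊢
    simpa [Function.comp_def, Fm.shift_subst_up] using this
  | allE t _ ih => rw [Fm.inst_subst]; exact .allE _ (ih σ ρ)
  | allSI _ ih =>
    refine .allSI ?_
    change Derivable T _ (Fm.subst σ (upS ρ) _)
    have := ih σ (upS ρ)
    rw [List.map_map] at this ⊢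
    simpa [Function.comp_def, Fm.shiftS_subst_upS] using this
  | allSE X _ ih => rw [Fm.instS_subst]; exact .allSE _ (ih σ ρ)
  | eqRefl t => exact .eqRefl _
  | eqSubst φ _ _ ih₁ ih₂ =>
    rw [Fm.inst_subst]
    exact .eqSubst _ (ih₁ σ ρ) (by have := ih₂ σ ρ; rwa [Fm.inst_subst] at this)

theorem exFalso (h : Derivable T Γ .falsum) : Derivable T Γ φ :=
  .raa (h.weaken (List.subset_cons_self _ _))

theorem cut (h₁ : Derivable T (ψ :: Γ) φ) (h₂ : Derivable T Γ ψ) : Derivable T Γ φ :=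
  .impE (.impI h₁) h₂

theorem of_neg_neg (h : Derivable T Γ φ.neg.neg) : Derivable T Γ φ :=
  .raa (.impE (h.weaken (List.subset_cons_self _ _)) (.hyp List.mem_cons_self))

/-- Generalization over a variable `c` that occurs neither in `Γ` nor in `φ`. The substitution that
sends `c` to `0` and shifts all other variables turns `φ[c]` back into `φ`, and it shifts `Γ`. -/
theorem exists_fresh (Γ : List Fm) (φ : Fm) :
    ∃ c, (Derivable T Γ (φ.inst (.var c)) → Derivable T Γ (.all φ)) ∧
      (Derivable T Γ (φ.instS c) → Derivable T Γ (.allS φ)) := by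
  have hΓ : ∃ N, ∀ ψ ∈ φ :: Γ, ∀ (σ τ : ℕ → Tm) (ρ π : ℕ → ℕ), (∀ n < N, σ n = τ n) →
      (∀ n < N, ρ n = π n) → ψ.subst σ ρ = ψ.subst τ π := by
    generalize φ :: Γ = Γ
    induction Γ with
    | nil => exact ⟨0, by simp⟩
    | cons ψ Γ ih =>
      obtain ⟨a, ha⟩ := ih
      obtain ⟨b, hb⟩ := ψ.exists_subst_congr
      refine ⟨max a b, fun χ hχ σ τ ρ π h h' => ?_⟩
      rcases List.mem_cons.1 hχ with rfl | hχ
      · exact hb σ τ ρ π (fun n hn => h n (by omega)) fun n hn => h' n (by omega)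
      · exact ha χ hχ σ τ ρ π (fun n hn => h n (by omega)) fun n hn => h' n (by omega)
  obtain ⟨N, hN⟩ := hΓ
  refine ⟨N, fun h => .allI ?_, fun h => .allSI ?_⟩
  · have := h.subst (fun n => if n = N then .var 0 else .var (n + 1)) id
    have e₁ : Γ.map (Fm.subst (fun n => if n = N then .var 0 else .var (n + 1)) id) =
        Γ.map Fm.shift := by
      refine List.map_congr_left fun ψ hψ => ?_
      refine hN ψ (List.mem_cons_of_mem _ hψ) _ _ _ _ (fun n hn => ?_) fun _ _ => rfl
      simp [hn.ne]
    have e₂ : (φ.inst (.var N)).subst (fun n => if n = N then .var 0 else .var (n + 1)) id = φ := by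
      rw [Fm.inst, Fm.subst_subst]
      conv_rhs => rw [← φ.subst_var]
      refine hN φ List.mem_cons_self _ _ _ _ (fun n hn => ?_) fun _ _ => rfl
      cases n with
      | zero => simp [scons, Tm.subst]
      | succ n => simp [scons, Tm.subst, show n ≠ N by omega]
    rwa [e₁, e₂] at this
  · have := h.subst .var (fun n => if n = N then 0 else n + 1)
    have e₁ : Γ.map (Fm.subst .var (fun n => if n = N then 0 else n + 1)) =
        Γ.map Fm.shiftS := by
      refine List.map_congr_left fun ψ hψ => ?_
      refine hN ψ (List.mem_cons_of_mem _ hψ) _ _ _ _ (fun _ _ => rfl) (fun n hn => ?_)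
      simp [hn.ne]
    have e₂ : (φ.instS N).subst .var (fun n => if n = N then 0 else n + 1) = φ := by
      rw [Fm.instS, Fm.subst_subst]
      conv_rhs => rw [← φ.subst_var]
      refine hN φ List.mem_cons_self _ _ _ _ (fun _ _ => Tm.subst_var _) (fun n hn => ?_)
      cases n with
      | zero => simp [scons]
      | succ n => simp [scons, show n ≠ N by omega]
    rwa [e₁, e₂] at this

theorem eq_congr {u v : Tm} (t : Tm) (h : Derivable T Γ (.eq u v)) :
    Derivable T Γ (.eq (t.subst (scons u .var)) (t.subst (scons v .var))) := by
  have key : ∀ w, (Fm.eq ((t.subst (scons u .var)).lift 1) t).inst w =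
      .eq (t.subst (scons u .var)) (t.subst (scons w .var)) := by
    intro w
    simp only [Fm.inst, Fm.subst, Tm.lift_subst_scons]
  have := Derivable.eqSubst (Fm.eq ((t.subst (scons u .var)).lift 1) t) h
    (by rw [key]; exact .eqRefl _)
  rwa [key] at this

end Derivable

/-! ### Semantics -/

/-- A structure for the language of second-order arithmetic; the second sort is a family of
subsets of the first. -/
class L2Structure (M : Type) extends Zero M, One M, Add M, Mul M, LT M where
  /-- The sets over which the set quantifiers range. -/
  sets : Set (Set M)


/-- The value of a term. -/
def Tm.eval {M : Type} [L2Structure M] (e : ℕ → M) : Tm → M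
  | .var n => e n
  | .zero => 0
  | .one => 1
  | .add s t => s.eval e + t.eval e
  | .mul s t => s.eval e * t.eval e

/-- Tarskian satisfaction. -/
def Fm.Sat {M : Type} [L2Structure M] : (ℕ → M) → (ℕ → L2Structure.sets (M := M)) → Fm → Prop
  | e, _, .eq s t => s.eval e = t.eval e
  | e, _, .lt s t => s.eval e < t.eval e
  | e, E, .mem t X => t.eval e ∈ (E X).1
  | _, _, .falsum => False
  | e, E, .imp φ ψ => φ.Sat e E → ψ.Sat e E
  | e, E, .all φ => ∀ x, φ.Sat (scons x e) E
  | e, E, .allS φ => ∀ X, φ.Sat e (scons X E)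

/-! ### Maximal consistent Henkin theories -/

/-- An injective numbering of the terms. -/
def Tm.code : Tm → ℕ
  | .var n => Nat.pair 0 n
  | .zero => Nat.pair 1 0
  | .one => Nat.pair 2 0
  | .add s t => Nat.pair 3 (Nat.pair s.code t.code)
  | .mul s t => Nat.pair 4 (Nat.pair s.code t.code)

theorem Tm.code_injective : Function.Injective Tm.code := by
  intro s
  induction s with
  | add s t hs ht | mul s t hs ht =>
    intro u h
    cases u <;> simp only [Tm.code, Nat.pair_eq_pair, reduceCtorEq, false_and, true_and] at h
    all_goals first | omega | rw [hs h.2.1, ht h.2.2] | rw [hs h.1, ht h.2]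
  | _ =>
    intro u h
    cases u <;> simp_all [Tm.code, Nat.pair_eq_pair]

/-- An injective numbering of the formulas. -/
def Fm.code : Fm → ℕ
  | .eq s t => Nat.pair 0 (Nat.pair s.code t.code)
  | .lt s t => Nat.pair 1 (Nat.pair s.code t.code)
  | .mem t X => Nat.pair 2 (Nat.pair t.code X)
  | .falsum => Nat.pair 3 0
  | .imp φ ψ => Nat.pair 4 (Nat.pair φ.code ψ.code)
  | .all φ => Nat.pair 5 φ.code
  | .allS φ => Nat.pair 6 φ.code

theorem Fm.code_injective : Function.Injective Fm.code := by
  intro φ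
  induction φ with
  | imp φ ψ h₁ h₂ =>
    intro χ h
    cases χ <;> simp only [Fm.code, Nat.pair_eq_pair, reduceCtorEq, true_and] at h
    all_goals first | exact h.1.elim | omega | rw [h₁ h.1, h₂ h.2]
  | all φ ih | allS φ ih =>
    intro χ h
    cases χ <;> simp only [Fm.code, Nat.pair_eq_pair, reduceCtorEq, true_and] at h
    all_goals first | exact h.1.elim | omega | rw [ih h]
  | _ =>
    intro χ h
    cases χ <;> simp_all [Fm.code, Nat.pair_eq_pair, Tm.code_injective.eq_iff]

instance : Countable Fm := Fm.code_injective.countable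

section Henkin

variable {T : Set Fm}

/-- One step of the Henkin construction: `φ` is decided, and if it is accepted and is the negation
of a universal formula, then a fresh variable is added as a counterexample. -/
theorem exists_henkin_step (Γ : List Fm) (hΓ : ¬ Derivable T Γ .falsum) (φ : Fm) :
    ∃ Δ, Γ ⊆ Δ ∧ ¬ Derivable T Δ .falsum ∧ (φ ∈ Δ ∨ Derivable T Δ φ.neg) ∧
      (∀ ψ, φ = (Fm.all ψ).neg → φ ∈ Δ → ∃ c, (ψ.inst (.var c)).neg ∈ Δ) ∧
      (∀ ψ, φ = (Fm.allS ψ).neg → φ ∈ Δ → ∃ c, (ψ.instS c).neg ∈ Δ) := by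
  by_cases hφ : Derivable T (φ :: Γ) .falsum
  · have hn : φ ∉ Γ := fun h => hΓ (hφ.cut (.hyp h))
    exact ⟨Γ, fun _ h => h, hΓ, .inr (.impI hφ), fun _ _ h => (hn h).elim,
      fun _ _ h => (hn h).elim⟩
  · by_cases h₁ : ∃ ψ, φ = (Fm.all ψ).neg
    · obtain ⟨ψ, rfl⟩ := h₁
      obtain ⟨c, hc, -⟩ := Derivable.exists_fresh (T := T) ((Fm.all ψ).neg :: Γ) ψ
      refine ⟨(ψ.inst (.var c)).neg :: (Fm.all ψ).neg :: Γ, by grind, fun h => hφ ?_,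
        .inl (by simp), fun χ h _ => ?_, fun χ h _ => ?_⟩
      · exact .impE (.hyp List.mem_cons_self) (hc (.raa h))
      · cases h; exact ⟨c, by simp⟩
      · cases h
    by_cases h₂ : ∃ ψ, φ = (Fm.allS ψ).neg
    · obtain ⟨ψ, rfl⟩ := h₂
      obtain ⟨c, -, hc⟩ := Derivable.exists_fresh (T := T) ((Fm.allS ψ).neg :: Γ) ψ
      refine ⟨(ψ.instS c).neg :: (Fm.allS ψ).neg :: Γ, by grind, fun h => hφ ?_,
        .inl (by simp), fun χ h _ => ?_, fun χ h _ => ?_⟩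
      · exact .impE (.hyp List.mem_cons_self) (hc (.raa h))
      · cases h
      · cases h; exact ⟨c, by simp⟩
    exact ⟨φ :: Γ, by grind, hφ, .inl (by simp), fun ψ h => (h₁ ⟨ψ, h⟩).elim,
      fun ψ h => (h₂ ⟨ψ, h⟩).elim⟩

/-- A deductively closed, consistent and complete set of formulas in which every refuted universal
formula has a counterexample among the variables. -/
structure IsHenkin (T : Set Fm) (Th : Set Fm) : Prop where
  closed : ∀ {Γ φ}, (∀ ψ ∈ Γ, ψ ∈ Th) → Derivable T Γ φ → φ ∈ Th
  falsum : Fm.falsum ∉ Th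
  complete : ∀ φ, φ ∈ Th ∨ φ.neg ∈ Th
  all_mem : ∀ φ, (∀ t, φ.inst t ∈ Th) → Fm.all φ ∈ Th
  allS_mem : ∀ φ, (∀ X, φ.instS X ∈ Th) → Fm.allS φ ∈ Th

theorem exists_isHenkin (Γ : List Fm) (hΓ : ¬ Derivable T Γ .falsum) :
    ∃ Th, IsHenkin T Th ∧ ∀ φ ∈ Γ, φ ∈ Th := by
  have : Nonempty Fm := ⟨.falsum⟩
  obtain ⟨f, hf⟩ := exists_surjective_nat Fm
  choose! step h₁ h₂ h₃ h₄ h₅ using exists_henkin_step (T := T)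
  let G : ℕ → List Fm := fun n => Nat.rec Γ (fun n Δ => step Δ (f n)) n
  have hG : ∀ n, ¬ Derivable T (G n) .falsum := fun n => by
    induction n with
    | zero => exact hΓ
    | succ n ih => exact h₂ _ ih (f n)
  have hmono : ∀ {n m}, n ≤ m → G n ⊆ G m := fun {n m} h => by
    induction h with
    | refl => exact fun _ h => h
    | step _ ih => exact fun _ h => h₁ _ (hG _) (f _) (ih h)
  have hcons : ∀ {φ n m}, Derivable T (G n) φ → Derivable T (G m) φ.neg → False := by
    intro φ n m hn hm
    refine hG (max n m) (.impE (hm.weaken ?_) (hn.weaken ?_))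
    · exact hmono (le_max_right n m)
    · exact hmono (le_max_left n m)
  have hcompl : ∀ φ, (∃ n, φ ∈ G n) ∨ ∃ n, Derivable T (G n) φ.neg := fun φ => by
    obtain ⟨n, rfl⟩ := hf φ
    exact (h₃ (G n) (hG n) (f n)).imp (fun h => ⟨n + 1, h⟩) fun h => ⟨n + 1, h⟩
  refine ⟨{φ | ∃ n, Derivable T (G n) φ}, ⟨?_, ?_, ?_, ?_, ?_⟩, fun φ h => ⟨0, .hyp h⟩⟩
  · intro Δ φ hΔ hφ
    induction Δ generalizing φ with
    | nil => exact ⟨0, hφ.weaken (by simp)⟩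
    | cons ψ Δ ih =>
      obtain ⟨n, hn⟩ := ih (fun χ hχ => hΔ χ (List.mem_cons_of_mem _ hχ)) (.impI hφ)
      obtain ⟨m, hm⟩ := hΔ ψ List.mem_cons_self
      exact ⟨max n m, .impE (hn.weaken (hmono (le_max_left n m)))
        (hm.weaken (hmono (le_max_right n m)))⟩
  · rintro ⟨n, hn⟩
    exact hG n hn
  · exact fun φ => (hcompl φ).imp_left fun ⟨n, h⟩ => ⟨n, .hyp h⟩
  · intro φ hφ
    obtain ⟨n, hn⟩ := hf (Fm.all φ).neg
    rcases h₃ (G n) (hG n) (f n) with h | h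
    · obtain ⟨c, hc⟩ := h₄ (G n) (hG n) (f n) φ hn h
      obtain ⟨m, hm⟩ := hφ (.var c)
      exact (hcons (n := m) (m := n + 1) hm (.hyp hc)).elim
    · have h' : Derivable T (G (n + 1)) (f n).neg := h
      rw [hn] at h'
      exact ⟨n + 1, h'.of_neg_neg⟩
  · intro φ hφ
    obtain ⟨n, hn⟩ := hf (Fm.allS φ).neg
    rcases h₃ (G n) (hG n) (f n) with h | h
    · obtain ⟨c, hc⟩ := h₅ (G n) (hG n) (f n) φ hn h
      obtain ⟨m, hm⟩ := hφ c
      exact (hcons (n := m) (m := n + 1) hm (.hyp hc)).elim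
    · have h' : Derivable T (G (n + 1)) (f n).neg := h
      rw [hn] at h'
      exact ⟨n + 1, h'.of_neg_neg⟩

/-! ### The term model and completeness -/

namespace IsHenkin

variable {Th : Set Fm} (H : IsHenkin T Th)
include H

theorem imp_mem {φ ψ : Fm} : φ.imp ψ ∈ Th ↔ (φ ∈ Th → ψ ∈ Th) := by
  refine ⟨fun h₁ h₂ => H.closed (Γ := [φ.imp ψ, φ]) (by simp [h₁, h₂])
    (.impE (φ := φ) (.hyp (by simp)) (.hyp (by simp))), fun h => ?_⟩
  rcases H.complete φ with h' | h'
  · exact H.closed (Γ := [ψ]) (by simp [h h']) (.impI (.hyp (by simp)))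
  · exact H.closed (Γ := [φ.neg]) (by simp [h'])
      (.impI (.exFalso (.impE (φ := φ) (.hyp (.tail _ List.mem_cons_self))
        (.hyp List.mem_cons_self))))

theorem eq_subst {s t : Tm} (φ : Fm) (h : Fm.eq s t ∈ Th) (hs : φ.inst s ∈ Th) :
    φ.inst t ∈ Th :=
  H.closed (Γ := [.eq s t, φ.inst s]) (by simp [h, hs])
    (.eqSubst φ (s := s) (.hyp (by simp)) (.hyp (by simp)))

theorem eq_congr {u v : Tm} (t : Tm) (h : Fm.eq u v ∈ Th) :
    .eq (t.subst (scons u .var)) (t.subst (scons v .var)) ∈ Th :=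
  H.closed (Γ := [.eq u v]) (by simp [h]) (.eq_congr t (.hyp (by simp)))

theorem eq_refl (t : Tm) : Fm.eq t t ∈ Th := H.closed (Γ := []) (by simp) (.eqRefl t)

theorem eq_symm {s t : Tm} (h : Fm.eq s t ∈ Th) : Fm.eq t s ∈ Th := by
  have := H.eq_subst (.eq (.var 0) (s.lift 1)) h
  simp only [Fm.inst, Fm.subst, Tm.lift_subst_scons] at this
  exact this (H.eq_refl s)

theorem eq_trans {s t u : Tm} (h : Fm.eq s t ∈ Th) (h' : Fm.eq t u ∈ Th) : Fm.eq s u ∈ Th := by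
  have := H.eq_subst (.eq (s.lift 1) (.var 0)) h'
  simp only [Fm.inst, Fm.subst, Tm.lift_subst_scons] at this
  exact this h

/-- Provable equality of terms. -/
def setoid : Setoid Tm where
  r s t := Fm.eq s t ∈ Th
  iseqv := ⟨H.eq_refl, H.eq_symm, H.eq_trans⟩

theorem binary_congr (op : Tm → Tm → Tm)
    (hop : ∀ s t σ, (op s t).subst σ = op (s.subst σ) (t.subst σ)) {s s' t t' : Tm}
    (hs : Fm.eq s s' ∈ Th) (ht : Fm.eq t t' ∈ Th) : Fm.eq (op s t) (op s' t') ∈ Th := by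
  have h₁ := H.eq_congr (op (.var 0) (t.lift 1)) hs
  have h₂ := H.eq_congr (op (s'.lift 1) (.var 0)) ht
  simp only [hop, Tm.lift_subst_scons] at h₁ h₂
  exact H.eq_trans h₁ h₂

theorem lt_congr {s s' t t' : Tm}
    (hs : Fm.eq s s' ∈ Th) (ht : Fm.eq t t' ∈ Th) (h : Fm.lt s t ∈ Th) : Fm.lt s' t' ∈ Th := by
  have h₁ := H.eq_subst (.lt (.var 0) (t.lift 1)) hs
  have h₂ := H.eq_subst (.lt (s'.lift 1) (.var 0)) ht
  simp only [Fm.inst, Fm.subst, Tm.lift_subst_scons] at h₁ h₂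
  exact h₂ (h₁ h)

theorem mem_congr {s t : Tm} {X : ℕ} (hs : Fm.eq s t ∈ Th) (h : Fm.mem s X ∈ Th) :
    Fm.mem t X ∈ Th :=
  H.eq_subst (.mem (.var 0) X) hs h

/-- The numbers of the term model: terms modulo provable equality. -/
def Carrier : Type := Quotient H.setoid

/-- The sets of the term model are the extensions of the set variables. -/
instance : L2Structure H.Carrier where
  zero := Quotient.mk _ .zero
  one := Quotient.mk _ .one
  add := Quotient.map₂ .add fun _ _ h _ _ h' => H.binary_congr .add (fun _ _ _ => rfl) h h'
  mul := Quotient.map₂ .mul fun _ _ h _ _ h' => H.binary_congr .mul (fun _ _ _ => rfl) h h'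
  lt := Quotient.lift₂ (fun s t => Fm.lt s t ∈ Th) fun _ _ _ _ h h' =>
    propext ⟨H.lt_congr h h', H.lt_congr (H.eq_symm h) (H.eq_symm h')⟩
  sets := Set.range fun X : ℕ => {x | Quotient.liftOn x (fun t => Fm.mem t X ∈ Th) fun _ _ h =>
    propext ⟨H.mem_congr h, H.mem_congr (H.eq_symm h)⟩}

/-- The element of the term model named by a term. -/
def quot (t : Tm) : H.Carrier := Quotient.mk _ t

/-- The set of the term model named by a set variable. -/
def mkSet (X : ℕ) : L2Structure.sets (M := H.Carrier) := ⟨_, X, rfl⟩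

theorem eval_quot (t : Tm) (σ : ℕ → Tm) : t.eval (fun n => H.quot (σ n)) = H.quot (t.subst σ) := by
  induction t with
  | var | zero | one => rfl
  | add s t hs ht | mul s t hs ht => rw [Tm.eval, hs, ht]; rfl

/-- In the term model, satisfaction is membership in the Henkin theory. -/
theorem sat_iff (φ : Fm) (σ : ℕ → Tm) (ρ : ℕ → ℕ) :
    φ.Sat (fun n => H.quot (σ n)) (fun n => H.mkSet (ρ n)) ↔ φ.subst σ ρ ∈ Th := by
  induction φ generalizing σ ρ with
  | eq s t =>
    rw [Fm.Sat, H.eval_quot, H.eval_quot]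
    exact Quotient.eq (r := H.setoid)
  | lt s t =>
    rw [Fm.Sat, H.eval_quot, H.eval_quot]
    rfl
  | mem t X =>
    rw [Fm.Sat, H.eval_quot]
    rfl
  | falsum => exact iff_of_false id H.falsum
  | imp φ ψ ih₁ ih₂ =>
    rw [Fm.Sat, ih₁, ih₂]
    exact H.imp_mem.symm
  | all φ ih =>
    have key : ∀ t, φ.Sat (scons (H.quot t) fun n => H.quot (σ n)) (fun n => H.mkSet (ρ n)) ↔
        (φ.subst (up σ) ρ).inst t ∈ Th := fun t => by
      rw [Fm.subst_up_inst, ← ih]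
      refine iff_of_eq (congrArg (Fm.Sat · _ φ) ?_)
      funext n; cases n <;> rfl
    refine ⟨fun h => H.all_mem _ fun t => (key t).1 (h _), fun h x => ?_⟩
    obtain ⟨t, rfl⟩ := Quotient.exists_rep x
    exact (key t).2 (H.closed (Γ := [Fm.all (φ.subst (up σ) ρ)])
      (fun _ hψ => List.mem_singleton.1 hψ ▸ h) (.allE t (.hyp (by simp))))
  | allS φ ih =>
    have key : ∀ X, φ.Sat (fun n => H.quot (σ n)) (scons (H.mkSet X) fun n => H.mkSet (ρ n)) ↔
        (φ.subst σ (upS ρ)).instS X ∈ Th := fun t => by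
      rw [Fm.subst_upS_instS, ← ih]
      refine iff_of_eq (congrArg (Fm.Sat _ · φ) ?_)
      funext n; cases n <;> rfl
    refine ⟨fun h => H.allS_mem _ fun X => (key X).1 (h _), fun h x => ?_⟩
    obtain ⟨_, X, rfl⟩ := x
    exact (key X).2 (H.closed (Γ := [Fm.allS (φ.subst σ (upS ρ))])
      (fun _ hψ => List.mem_singleton.1 hψ ▸ h) (.allSE X (.hyp (by simp))))

end IsHenkin

/-- **Completeness**: what holds in all models of `T`, under all assignments, is provable. -/
theorem proves_of_forall_sat {φ : Fm}
    (h : ∀ (M : Type) [L2Structure M],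
      (∀ ψ ∈ T, ∀ (e : ℕ → M) (E : ℕ → L2Structure.sets (M := M)), ψ.Sat e E) →
      ∀ (e : ℕ → M) (E : ℕ → L2Structure.sets (M := M)), φ.Sat e E) : Proves T φ := by
  refine .raa ?_
  by_contra hcon
  obtain ⟨Th, H, hφ⟩ := exists_isHenkin _ hcon
  have hsat := h H.Carrier (fun ψ hψ e E => ?_) (fun n => H.quot (.var n)) (fun n => H.mkSet n)
  · have h₁ := (H.sat_iff φ .var id).1 hsat
    rw [Fm.subst_var] at h₁
    exact H.falsum ((H.imp_mem).1 (hφ _ List.mem_cons_self) h₁)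
  · choose σ hσ using fun n => Quotient.exists_rep (e n)
    choose ρ hρ using fun n => (E n).2
    have he : e = fun n => H.quot (σ n) := funext fun n => (hσ n).symm
    have hE : E = fun n => H.mkSet (ρ n) := funext fun n => Subtype.ext (hρ n).symm
    rw [he, hE, H.sat_iff]
    exact H.closed (Γ := []) (by simp) (.axm_subst hψ σ ρ)

end Henkin

/-! ### Satisfaction -/

section Sat

variable {M : Type} [L2Structure M] (e : ℕ → M) (E : ℕ → L2Structure.sets (M := M))

theorem Tm.eval_subst (t : Tm) (σ : ℕ → Tm) :
    (t.subst σ).eval e = t.eval fun n => (σ n).eval e := by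
  induction t <;> simp_all [Tm.subst, Tm.eval]

theorem Tm.eval_lift (t : Tm) (k : ℕ) : (t.lift k).eval e = t.eval fun n => e (n + k) :=
  t.eval_subst e _

theorem Fm.sat_subst (φ : Fm) (σ : ℕ → Tm) (ρ : ℕ → ℕ) :
    (φ.subst σ ρ).Sat e E ↔ φ.Sat (fun n => (σ n).eval e) (fun n => E (ρ n)) := by
  induction φ generalizing e E σ ρ with
  | eq | lt | mem => simp [Fm.subst, Fm.Sat, Tm.eval_subst]
  | falsum => rfl
  | imp φ ψ ih₁ ih₂ => simp only [Fm.subst, Fm.Sat, ih₁, ih₂]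
  | all φ ih =>
    refine forall_congr' fun x => (ih (scons x e) E (up σ) ρ).trans (iff_of_eq ?_)
    congr 1
    funext n
    cases n with
    | zero => rfl
    | succ n => exact Tm.eval_lift _ _ _
  | allS φ ih =>
    refine forall_congr' fun X => (ih e (scons X E) σ (upS ρ)).trans (iff_of_eq ?_)
    congr 1
    funext n; cases n <;> rfl

@[simp] theorem Fm.sat_neg (φ : Fm) : φ.neg.Sat e E ↔ ¬ φ.Sat e E := Iff.rfl

@[simp] theorem Fm.sat_imp (φ ψ : Fm) : (φ.imp ψ).Sat e E ↔ (φ.Sat e E → ψ.Sat e E) := Iff.rfl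

@[simp] theorem Fm.sat_all (φ : Fm) : φ.all.Sat e E ↔ ∀ x, φ.Sat (scons x e) E := Iff.rfl

@[simp] theorem Fm.sat_allS (φ : Fm) : φ.allS.Sat e E ↔ ∀ X, φ.Sat e (scons X E) := Iff.rfl

@[simp] theorem Fm.sat_or (φ ψ : Fm) : (φ.or ψ).Sat e E ↔ φ.Sat e E ∨ ψ.Sat e E := by
  simp [Fm.or, or_iff_not_imp_left]

@[simp] theorem Fm.sat_and (φ ψ : Fm) : (φ.and ψ).Sat e E ↔ φ.Sat e E ∧ ψ.Sat e E := by
  simp [Fm.and]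

@[simp] theorem Fm.sat_iff (φ ψ : Fm) : (φ.iff ψ).Sat e E ↔ (φ.Sat e E ↔ ψ.Sat e E) := by
  simp [Fm.iff, iff_iff_implies_and_implies]

@[simp] theorem Fm.sat_ex (φ : Fm) : φ.ex.Sat e E ↔ ∃ x, φ.Sat (scons x e) E := by
  simp [Fm.ex]

@[simp] theorem Fm.sat_exS (φ : Fm) : φ.exS.Sat e E ↔ ∃ X, φ.Sat e (scons X E) := by
  simp [Fm.exS]

@[simp] theorem Fm.sat_ball (t : Tm) (φ : Fm) :
    (φ.ball t).Sat e E ↔ ∀ x, x < t.eval e → φ.Sat (scons x e) E := by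
  simp only [Fm.ball, Fm.sat_all, Fm.sat_imp]
  simp only [Fm.Sat, Tm.eval_lift]
  rfl

@[simp] theorem Fm.sat_bex (t : Tm) (φ : Fm) :
    (φ.bex t).Sat e E ↔ ∃ x, x < t.eval e ∧ φ.Sat (scons x e) E := by
  simp only [Fm.bex, Fm.sat_ex, Fm.sat_and]
  simp only [Fm.Sat, Tm.eval_lift]
  rfl

end Sat

theorem IsArithmetical.subst {φ : Fm} (h : IsArithmetical φ) (σ : ℕ → Tm) (ρ : ℕ → ℕ) :
    IsArithmetical (φ.subst σ ρ) := by
  induction φ generalizing σ ρ with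
  | eq | lt | mem | falsum => trivial
  | imp _ _ ih₁ ih₂ => exact ⟨ih₁ h.1 _ _, ih₂ h.2 _ _⟩
  | all _ ih => exact ih h _ _
  | allS => exact h

/-! ### Arithmetical predicates in a model of `ACA₀` -/

/-- A model of `ACA₀`. The second sort is required to be nonempty because an assignment is needed to
make use of an axiom. -/
class ACAModel (M : Type) extends L2Structure M where
  sat : ∀ φ ∈ ACA0, ∀ (e : ℕ → M) (E : ℕ → L2Structure.sets (M := M)), φ.Sat e E
  sets_nonempty : Nonempty (L2Structure.sets (M := M))

variable {M : Type} [ACAModel M]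

/-- `X` is a set of the model. -/
class IsSet (X : Set M) : Prop where
  mem_sets : X ∈ L2Structure.sets

/-- The predicate `P` of assignments is arithmetical: it is given by an arithmetical formula with
set parameters, in which every number variable stands for a coordinate of the assignment
(`.inr`) or for a parameter (`.inl`). Instances of this class mirror the syntax of formulas; a
bound variable becomes coordinate `0`. -/
class Ar (P : (ℕ → M) → Prop) : Prop where
  out : ∃ (φ : Fm) (E : ℕ → L2Structure.sets (M := M)) (v : ℕ → M ⊕ ℕ), IsArithmetical φ ∧
    ∀ e, P e ↔ φ.Sat (fun n => Sum.elim id e (v n)) E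

/-- The function `f` of assignments has an arithmetical graph; the value is coordinate `0`. -/
class ArF (f : (ℕ → M) → M) : Prop where
  out : Ar fun e => f (fun n => e (n + 1)) = e 0

namespace Ar

variable {P Q : (ℕ → M) → Prop}

theorem of_iff [hP : Ar P] (h : ∀ e, Q e ↔ P e) : Ar Q := by
  obtain ⟨φ, E, v, hφ, hv⟩ := hP
  exact ⟨φ, E, v, hφ, fun e => (h e).trans (hv e)⟩

/-- Two sequences are the even and the odd part of a third; this keeps the variables of two formulas
apart. -/
theorem interleave {α : Type} (v w : ℕ → α) :
    ∃ u : ℕ → α, (∀ n, u (2 * n) = v n) ∧ ∀ n, u (2 * n + 1) = w n :=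
  ⟨fun n => if n % 2 = 0 then v (n / 2) else w (n / 2), fun n => by simp,
    fun n => by simp [Nat.add_mod, show (2 * n + 1) / 2 = n by omega]⟩

instance imp [hP : Ar P] [hQ : Ar Q] : Ar fun e => P e → Q e := by
  obtain ⟨φ, E, v, hφ, hv⟩ := hP
  obtain ⟨ψ, F, w, hψ, hw⟩ := hQ
  obtain ⟨u, hu₁, hu₂⟩ := interleave v w
  obtain ⟨G, hG₁, hG₂⟩ := interleave E F
  refine ⟨(φ.subst (fun n => .var (2 * n)) (2 * ·)).imp
    (ψ.subst (fun n => .var (2 * n + 1)) (2 * · + 1)), G, u,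
    ⟨hφ.subst _ _, hψ.subst _ _⟩, fun e => ?_⟩
  simp only [Fm.sat_imp, Fm.sat_subst, Tm.eval, hu₁, hu₂, hG₁, hG₂, hv, hw]

instance const (p : Prop) : Ar fun _ : ℕ → M => p := by
  obtain ⟨X⟩ := ACAModel.sets_nonempty (M := M)
  by_cases hp : p
  · exact ⟨Fm.falsum.neg, fun _ => X, .inr, ⟨trivial, trivial⟩, fun e => by simp [hp, Fm.Sat]⟩
  · exact ⟨.falsum, fun _ => X, .inr, trivial, fun e => by simp [hp, Fm.Sat]⟩

instance not [Ar P] : Ar fun e => ¬ P e := imp (Q := fun _ => False)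

instance or [Ar P] [Ar Q] : Ar fun e => P e ∨ Q e :=
  of_iff (P := fun e => ¬ P e → Q e) fun _ => or_iff_not_imp_left

instance and [Ar P] [Ar Q] : Ar fun e => P e ∧ Q e :=
  of_iff (P := fun e => ¬ (P e → ¬ Q e)) fun e => by simp

instance iff [Ar P] [Ar Q] : Ar fun e => P e ↔ Q e :=
  of_iff (P := fun e => (P e → Q e) ∧ (Q e → P e)) fun _ => iff_iff_implies_and_implies

open Classical in
instance all {P : M → (ℕ → M) → Prop} [h : Ar fun e => P (e 0) fun n => e (n + 1)] :
    Ar fun e => ∀ x, P x e := by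
  obtain ⟨φ, E, v, hφ, hv⟩ := h
  refine ⟨.all (φ.subst (fun n => .var (if v n = .inr 0 then 0 else n + 1)) id), E,
    fun n => (v n).map id Nat.pred, hφ.subst _ _, fun e => forall_congr' fun x => ?_⟩
  have := hv (scons x e)
  simp only [scons] at this
  rw [this, Fm.sat_subst]
  refine iff_of_eq (congrArg (Fm.Sat · _ φ) (funext fun n => ?_))
  rcases hn : v n with m | (_ | k) <;> simp [Tm.eval, scons, hn]

instance ex {P : M → (ℕ → M) → Prop} [Ar fun e => P (e 0) fun n => e (n + 1)] :
    Ar fun e => ∃ x, P x e :=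
  of_iff (P := fun e => ¬ ∀ x, ¬ P x e) fun e => by simp

/-- Renaming of coordinates. -/
theorem rename (h : Ar P) (r : ℕ → ℕ) : Ar fun e => P fun n => e (r n) := by
  obtain ⟨φ, E, v, hφ, hv⟩ := h
  refine ⟨φ, E, fun n => (v n).map id r, hφ, fun e => (hv _).trans (iff_of_eq ?_)⟩
  refine congrArg (Fm.Sat · _ φ) (funext fun n => ?_)
  cases hn : v n <;> simp [hn]

theorem add_graph : Ar fun e : ℕ → M => e 1 + e 2 = e 0 := by
  obtain ⟨X⟩ := ACAModel.sets_nonempty (M := M)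
  exact ⟨.eq (.add (.var 1) (.var 2)) (.var 0), fun _ => X, .inr, trivial, fun _ => Iff.rfl⟩

theorem mul_graph : Ar fun e : ℕ → M => e 1 * e 2 = e 0 := by
  obtain ⟨X⟩ := ACAModel.sets_nonempty (M := M)
  exact ⟨.eq (.mul (.var 1) (.var 2)) (.var 0), fun _ => X, .inr, trivial, fun _ => Iff.rfl⟩

theorem eq_coord : Ar fun e : ℕ → M => e 0 = e 1 := by
  obtain ⟨X⟩ := ACAModel.sets_nonempty (M := M)
  exact ⟨.eq (.var 0) (.var 1), fun _ => X, .inr, trivial, fun _ => Iff.rfl⟩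

theorem lt_coord : Ar fun e : ℕ → M => e 0 < e 1 := by
  obtain ⟨X⟩ := ACAModel.sets_nonempty (M := M)
  exact ⟨.lt (.var 0) (.var 1), fun _ => X, .inr, trivial, fun _ => Iff.rfl⟩

theorem mem_coord (X : Set M) [h : IsSet X] : Ar fun e : ℕ → M => e 0 ∈ X :=
  ⟨.mem (.var 0) 0, fun _ => ⟨X, h.mem_sets⟩, .inr, trivial, fun _ => Iff.rfl⟩

/-- Substitution of an arithmetical function for coordinate `0`. -/
theorem comp (hP : Ar P) (f : (ℕ → M) → M) [hf : ArF f] : Ar fun e => P (scons (f e) e) := by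
  have := hf.out
  have h : Ar fun e => ∃ y, f e = y ∧ P (scons y e) := by
    have : Ar fun e : ℕ → M => P (scons (e 0) fun n => e (n + 1)) :=
      of_iff (P := P) fun e => by
        refine iff_of_eq (congrArg P (funext fun n => ?_)); cases n <;> rfl
    exact ex (P := fun y e => f e = y ∧ P (scons y e))
  exact of_iff (P := fun e => ∃ y, f e = y ∧ P (scons y e)) fun e => by simp

/-- Substitution of two arithmetical functions in a binary predicate. -/
theorem comp₂ {R : M → M → Prop} (hR : Ar fun e => R (e 0) (e 1)) (f g : (ℕ → M) → M)
    [hf : ArF f] [hg : ArF g] : Ar fun e => R (f e) (g e) := by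
  have h₁ : Ar fun e : ℕ → M => R (e 0) (g fun n => e (n + 1)) := by
    have hg' : ArF fun e : ℕ → M => g fun n => e (n + 1) :=
      ⟨hg.out.rename fun n => if n = 0 then 0 else n + 1⟩
    exact comp (P := fun e => R (e 1) (e 0)) (hR.rename fun n => if n = 0 then 1 else 0) _
  exact comp h₁ f

/-- Substitution of three arithmetical functions in a ternary predicate. -/
theorem comp₃ {R : M → M → M → Prop} (hR : Ar fun e => R (e 0) (e 1) (e 2))
    (f g h : (ℕ → M) → M) [hf : ArF f] [hg : ArF g] [hh : ArF h] :
    Ar fun e => R (f e) (g e) (h e) := by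
  have h₁ : Ar fun e : ℕ → M => R (e 0) (g fun n => e (n + 1)) (h fun n => e (n + 1)) := by
    have hg' : ArF fun e : ℕ → M => g fun n => e (n + 1) :=
      ⟨hg.out.rename fun n => if n = 0 then 0 else n + 1⟩
    have hh' : ArF fun e : ℕ → M => h fun n => e (n + 1 + 1) :=
      ⟨hh.out.rename fun n => if n = 0 then 0 else n + 2⟩
    have h₂ : Ar fun e : ℕ → M => R (e 1) (e 0) (h fun n => e (n + 1 + 1)) :=
      comp (P := fun e => R (e 2) (e 1) (e 0))
        (hR.rename fun n => if n = 0 then 2 else if n = 1 then 1 else 0) _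
    exact comp (P := fun e => R (e 1) (e 0) (h fun n => e (n + 1 + 1))) h₂ _
  exact comp h₁ f

variable (f g : (ℕ → M) → M) [ArF f] [ArF g]

instance eq : Ar fun e => f e = g e := eq_coord.comp₂ f g

instance lt : Ar fun e => f e < g e := lt_coord.comp₂ f g

instance mem (X : Set M) [IsSet X] : Ar fun e => f e ∈ X := (mem_coord X).comp f

end Ar

namespace ArF

instance coord (k : ℕ) : ArF fun e : ℕ → M => e k :=
  ⟨Ar.eq_coord.rename fun n => if n = 0 then k + 1 else 0⟩

instance const (a : M) : ArF fun _ : ℕ → M => a := by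
  obtain ⟨X⟩ := ACAModel.sets_nonempty (M := M)
  exact ⟨⟨.eq (.var 0) (.var 1), fun _ => X, fun n => if n = 0 then .inl a else .inr 0, trivial,
    fun e => Iff.rfl⟩⟩

variable (f g : (ℕ → M) → M) [hf : ArF f] [hg : ArF g]

instance add : ArF fun e => f e + g e := by
  have hf' : ArF fun e : ℕ → M => f fun n => e (n + 1) :=
    ⟨hf.out.rename fun n => if n = 0 then 0 else n + 1⟩
  have hg' : ArF fun e : ℕ → M => g fun n => e (n + 1) :=
    ⟨hg.out.rename fun n => if n = 0 then 0 else n + 1⟩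
  exact ⟨Ar.comp₃ (R := fun a b c => b + c = a) Ar.add_graph (fun e => e 0) _ _⟩

instance mul : ArF fun e => f e * g e := by
  have hf' : ArF fun e : ℕ → M => f fun n => e (n + 1) :=
    ⟨hf.out.rename fun n => if n = 0 then 0 else n + 1⟩
  have hg' : ArF fun e : ℕ → M => g fun n => e (n + 1) :=
    ⟨hg.out.rename fun n => if n = 0 then 0 else n + 1⟩
  exact ⟨Ar.comp₃ (R := fun a b c => b * c = a) Ar.mul_graph (fun e => e 0) _ _⟩

end ArF

/-- Arithmetical comprehension. -/
theorem isSet_setOf (P : M → Prop) [h : Ar fun e : ℕ → M => P (e 0)] : IsSet {x | P x} := by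
  obtain ⟨φ, E, v, hφ, hv⟩ := h
  have h := ACAModel.sat _ (.inr ⟨_, hφ.subst
    (fun n => .var (Sum.elim (fun _ => n + 1) (fun _ => 0) (v n))) id, rfl⟩)
    (fun n => Sum.elim id (fun _ => 0) (v n)) E
  simp only [comprehension, Fm.shiftS, Fm.sat_exS, Fm.sat_all, Fm.sat_iff, Fm.sat_subst] at h
  obtain ⟨X, hX⟩ := h
  have hX' : X.1 = {x | P x} := by
    ext x
    refine (hX x).trans (Iff.trans (iff_of_eq ?_) (hv fun _ => x).symm)
    refine congrArg (Fm.Sat · _ φ) (funext fun n => ?_)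
    cases hn : v n <;> simp [hn, Tm.eval, scons]
  exact ⟨hX' ▸ X.2⟩

/-- Arithmetical induction. -/
theorem induct (P : M → Prop) [Ar fun e : ℕ → M => P (e 0)] (zero : P 0)
    (succ : ∀ x, P x → P (x + 1)) (x : M) : P x := by
  have hX := isSet_setOf P
  have h := ACAModel.sat _ (.inl (.inl (.inr ⟨_, ⟨.mem (.var 1) 0, .mem _ _, rfl⟩, rfl⟩)))
    (fun _ => (0 : M)) (fun _ => ⟨_, hX.mem_sets⟩)
  simp only [induction, Fm.inst, Fm.sat_imp, Fm.sat_and, Fm.sat_all, Fm.sat_subst, Fm.sat_ex] at h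
  obtain ⟨_, hx⟩ := h ⟨⟨0, zero⟩, fun x ⟨_, hx⟩ => ⟨0, succ x hx⟩⟩ x
  exact hx

/-! ### The numbers of a model as an ordered semiring -/

section Basic

theorem sat_basic {φ : Fm} (h : φ ∈ basicAxioms) : φ.Sat (M := M) (fun _ => 0)
    fun _ => (ACAModel.sets_nonempty (M := M)).some :=
  ACAModel.sat _ (.inl (.inl (.inl h))) _ _

theorem succ_ne_zero' (n : M) : n + 1 ≠ 0 :=
  sat_basic (M := M) (φ := .all (Fm.eq (.add (.var 0) .one) .zero).neg) (by simp [basicAxioms]) n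

theorem succ_inj' {m n : M} (h : m + 1 = n + 1) : m = n :=
  sat_basic (M := M) (φ := .all (.all ((Fm.eq (.add (.var 1) .one) (.add (.var 0) .one)).imp
    (.eq (.var 1) (.var 0))))) (by simp [basicAxioms]) m n h

theorem add_zero' (n : M) : n + 0 = n :=
  sat_basic (M := M) (φ := .all (.eq (.add (.var 0) .zero) (.var 0))) (by simp [basicAxioms]) n

theorem add_succ' (m n : M) : m + (n + 1) = m + n + 1 :=
  sat_basic (M := M) (φ := .all (.all (.eq (.add (.var 1) (.add (.var 0) .one))
    (.add (.add (.var 1) (.var 0)) .one)))) (by simp [basicAxioms]) m n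

theorem mul_zero' (n : M) : n * 0 = 0 :=
  sat_basic (M := M) (φ := .all (.eq (.mul (.var 0) .zero) .zero)) (by simp [basicAxioms]) n

theorem mul_succ' (m n : M) : m * (n + 1) = m * n + m :=
  sat_basic (M := M) (φ := .all (.all (.eq (.mul (.var 1) (.add (.var 0) .one))
    (.add (.mul (.var 1) (.var 0)) (.var 1))))) (by simp [basicAxioms]) m n

theorem not_lt_zero' (n : M) : ¬ n < 0 :=
  sat_basic (M := M) (φ := .all (Fm.lt (.var 0) .zero).neg) (by simp [basicAxioms]) n

theorem lt_succ_iff' (m n : M) : m < n + 1 ↔ m < n ∨ m = n := by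
  have := sat_basic (M := M) (φ := .all (.all ((Fm.lt (.var 1) (.add (.var 0) .one)).iff
    ((Fm.lt (.var 1) (.var 0)).or (.eq (.var 1) (.var 0)))))) (by simp [basicAxioms]) m n
  exact ((Fm.sat_iff ..).1 this).trans (Fm.sat_or ..)

theorem zero_add' (n : M) : 0 + n = n :=
  induct (fun n : M => 0 + n = n) (add_zero' 0) (fun n h => by rw [add_succ', h]) n

theorem succ_add' (m n : M) : m + 1 + n = m + n + 1 :=
  induct (fun n : M => m + 1 + n = m + n + 1) (by rw [add_zero', add_zero'])
    (fun n h => by rw [add_succ', h, add_succ']) n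

theorem add_comm' (m n : M) : m + n = n + m :=
  induct (fun n : M => m + n = n + m) (by rw [add_zero', zero_add'])
    (fun n h => by rw [add_succ', h, succ_add']) n

theorem add_assoc' (k m n : M) : k + m + n = k + (m + n) :=
  induct (fun n : M => k + m + n = k + (m + n)) (by rw [add_zero', add_zero'])
    (fun n h => by rw [add_succ', h, add_succ', add_succ']) n

theorem zero_mul' (n : M) : 0 * n = 0 :=
  induct (fun n : M => 0 * n = 0) (mul_zero' 0)
    (fun n h => by rw [mul_succ', h, add_zero']) n

theorem succ_mul' (m n : M) : (m + 1) * n = m * n + n :=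
  induct (fun n : M => (m + 1) * n = m * n + n)
    (by rw [mul_zero', mul_zero', add_zero'])
    (fun n h => by
      rw [mul_succ', h, mul_succ', add_succ', add_succ', add_assoc', add_assoc', add_comm' n,
        succ_add', add_succ', ← add_assoc' (m * n)]) n

theorem mul_comm' (m n : M) : m * n = n * m :=
  induct (fun n : M => m * n = n * m) (by rw [mul_zero', zero_mul'])
    (fun n h => by rw [mul_succ', h, succ_mul']) n

theorem mul_add' (k m n : M) : k * (m + n) = k * m + k * n :=
  induct (fun n : M => k * (m + n) = k * m + k * n)
    (by rw [add_zero', mul_zero', add_zero'])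
    (fun n h => by rw [add_succ', mul_succ', h, mul_succ', add_assoc']) n

theorem mul_assoc' (k m n : M) : k * m * n = k * (m * n) :=
  induct (fun n : M => k * m * n = k * (m * n)) (by simp only [mul_zero'])
    (fun n h => by rw [mul_succ', h, mul_succ', mul_add']) n

theorem one_mul' (n : M) : 1 * n = n :=
  induct (fun n : M => 1 * n = n) (mul_zero' 1) (fun n h => by rw [mul_succ', h]) n

theorem add_right_cancel' {k m n : M} : m + k = n + k → m = n :=
  induct (fun k : M => m + k = n + k → m = n)
    (by simp only [add_zero']; exact id)
    (fun k ih h => ih (by simp only [add_succ'] at h; exact succ_inj' h)) k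

theorem eq_zero_or_succ (n : M) : n = 0 ∨ ∃ m, n = m + 1 :=
  induct (fun n : M => n = 0 ∨ ∃ m, n = m + 1) (.inl rfl) (fun n _ => .inr ⟨n, rfl⟩) n

theorem lt_iff_exists_add_succ (m n : M) : m < n ↔ ∃ d, n = m + (d + 1) :=
  induct (fun n : M => m < n ↔ ∃ d, n = m + (d + 1))
    (iff_of_false (not_lt_zero' m) fun ⟨d, hd⟩ =>
      succ_ne_zero' _ ((add_succ' m d).symm.trans hd.symm))
    (fun n ih => by
      rw [lt_succ_iff', ih]
      constructor
      · rintro (⟨d, rfl⟩ | rfl)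
        · exact ⟨d + 1, (add_succ' m (d + 1)).symm⟩
        · exact ⟨0, by rw [zero_add']⟩
      · rintro ⟨d, hd⟩
        rw [add_succ'] at hd
        obtain rfl := succ_inj' hd
        rcases eq_zero_or_succ d with rfl | ⟨d, rfl⟩
        · exact .inr (add_zero' m).symm
        · exact .inl ⟨d, rfl⟩) n

theorem le_total' (m n : M) : (∃ d, n = m + d) ∨ ∃ d, m = n + d :=
  induct (fun n : M => (∃ d, n = m + d) ∨ ∃ d, m = n + d)
    (.inr ⟨m, (zero_add' m).symm⟩)
    (fun n ih => by
      rcases ih with ⟨d, rfl⟩ | ⟨d, rfl⟩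
      · exact .inl ⟨d + 1, (add_succ' m d).symm⟩
      · rcases eq_zero_or_succ d with rfl | ⟨d, rfl⟩
        · exact .inl ⟨1, by rw [add_zero']⟩
        · exact .inr ⟨d, by rw [add_succ', succ_add']⟩) n

instance : CommSemiring M where
  add_assoc := add_assoc'
  zero_add := zero_add'
  add_zero := add_zero'
  add_comm := add_comm'
  mul_assoc := mul_assoc'
  one_mul := one_mul'
  mul_one n := by rw [mul_comm', one_mul']
  mul_comm := mul_comm'
  zero_mul := zero_mul'
  mul_zero := mul_zero'
  left_distrib := mul_add'
  right_distrib k m n := by rw [mul_comm', mul_add', mul_comm' n, mul_comm' n]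
  nsmul := nsmulRec

instance : IsCancelAdd M where
  add_left_cancel k m n h := add_right_cancel' (k := k) (by rwa [add_comm m, add_comm n])
  add_right_cancel _ _ _ := add_right_cancel'

theorem eq_zero_of_add_eq_zero' {m n : M} (h : m + n = 0) : n = 0 := by
  rcases eq_zero_or_succ n with rfl | ⟨n, rfl⟩
  · rfl
  · exact (succ_ne_zero' _ ((add_succ' m n).symm.trans h)).elim

open Classical in
noncomputable instance : LinearOrder M where
  le m n := ∃ d, n = m + d
  le_refl n := ⟨0, (add_zero n).symm⟩
  le_trans := by rintro k _ _ ⟨a, rfl⟩ ⟨b, rfl⟩; exact ⟨a + b, add_assoc _ _ _⟩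
  le_antisymm := by
    rintro m _ ⟨a, rfl⟩ ⟨b, h⟩
    have : a + b = 0 := add_left_cancel (a := m) (by rw [← add_assoc, ← h, add_zero])
    rw [eq_zero_of_add_eq_zero' ((add_comm b a).trans this), add_zero]
  le_total := le_total'
  lt_iff_le_not_ge m n := by
    rw [lt_iff_exists_add_succ]
    constructor
    · rintro ⟨d, rfl⟩
      refine ⟨⟨_, rfl⟩, fun ⟨b, h⟩ => succ_ne_zero' (b + d) ?_⟩
      exact add_left_cancel (a := m) (by rw [add_zero]; conv_rhs => rw [h]
                                         ac_rfl)
    · rintro ⟨⟨d, rfl⟩, h⟩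
      rcases eq_zero_or_succ d with rfl | ⟨d, rfl⟩
      · exact (h ⟨0, by simp⟩).elim
      · exact ⟨d, rfl⟩
  toDecidableLE := Classical.decRel _

instance : CanonicallyOrderedAdd M where
  exists_add_of_le h := h
  le_self_add _ b := ⟨b, rfl⟩
  le_add_self _ b := ⟨b, add_comm _ _⟩

instance : IsOrderedAddMonoid M where
  add_le_add_left := by rintro a _ ⟨d, rfl⟩ c; exact ⟨d, by ac_rfl⟩

instance : IsStrictOrderedRing M :=
  have hmul : ∀ a : M, 0 < a → ∀ b c : M, b < c → a * b < a * c := by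
    intro a ha b c hbc
    obtain ⟨d, rfl⟩ := (lt_iff_exists_add_succ b c).1 hbc
    obtain ⟨a, rfl⟩ := (lt_iff_exists_add_succ 0 a).1 ha
    exact (lt_iff_exists_add_succ _ _).2 ⟨a * (d + 1) + d, by ring⟩
  { exists_pair_ne := ⟨0, 1, fun h => succ_ne_zero' (0 : M) (by rw [zero_add]; exact h.symm)⟩
    zero_le_one := ⟨1, (zero_add 1).symm⟩
    le_of_add_le_add_left := by
      rintro a b c ⟨d, h⟩
      exact ⟨d, add_left_cancel (a := a) (by rw [h, add_assoc])⟩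
    mul_lt_mul_of_pos_left := fun _ ha _ _ h => hmul _ ha _ _ h
    mul_lt_mul_of_pos_right := fun a ha b c h => by
      simpa only [mul_comm _ a] using hmul a ha b c h }

theorem lt_add_one_iff' {m n : M} : m < n + 1 ↔ m ≤ n := by
  rw [lt_succ_iff', le_iff_lt_or_eq]

end Basic

/-! ### Codes of finite sets -/

/-- The least number principle. -/
theorem exists_least (P : M → Prop) [Ar fun e : ℕ → M => P (e 0)] (h : ∃ x, P x) :
    ∃ x, P x ∧ ∀ y < x, ¬ P y := by
  by_contra! hcon
  obtain ⟨x, hx⟩ := h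
  have key : ∀ x, ∀ y, y < x → ¬ P y := by
    refine induct (fun x => ∀ y, y < x → ¬ P y) (fun y hy => (not_lt_zero' y hy).elim) ?_
    intro x ih y hy hPy
    obtain ⟨z, hz, hPz⟩ := hcon y hPy
    exact ih z (hz.trans_le (lt_add_one_iff'.1 hy)) hPz
  exact key (x + 1) x (lt_add_one_iff'.2 le_rfl) hx

/-- The ordered pair of `x` and `y`. -/
def opair (x y : M) : M := (x + y) * (x + y) + x

instance (f g : (ℕ → M) → M) [ArF f] [ArF g] : ArF fun e => opair (f e) (g e) :=
  inferInstanceAs (ArF fun e => (f e + g e) * (f e + g e) + f e)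

theorem opair_inj {x y x' y' : M} : opair x y = opair x' y' ↔ x = x' ∧ y = y' := by
  refine ⟨fun h => ?_, fun ⟨h₁, h₂⟩ => by rw [h₁, h₂]⟩
  have key : ∀ x y x' y' : M, x + y < x' + y' → opair x y < opair x' y' := by
    intro x y x' y' hlt
    obtain ⟨d, hd⟩ := (lt_iff_exists_add_succ _ _).1 hlt
    refine (lt_iff_exists_add_succ _ _).2 ⟨y + (x + y) + 2 * d * (x + y) + 2 * d + d * d + x', ?_⟩
    rw [opair, opair, hd]
    ring
  have hs : x + y = x' + y' := by
    rcases lt_trichotomy (x + y) (x' + y') with h' | h' | h'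
    · exact absurd h (key _ _ _ _ h').ne
    · exact h'
    · exact absurd h (key _ _ _ _ h').ne'
  rw [opair, opair, hs] at h
  obtain rfl := add_left_cancel h
  exact ⟨rfl, add_left_cancel hs⟩

/-- `i` belongs to the finite set coded by `w`: the code is a triple `(a, b, n)`, and `i` is in the
set iff `i < n` and `1 + (i + 1) b` divides `a`. -/
def InCode (i w : M) : Prop :=
  ∃ a b n, w = opair (opair a b) n ∧ i < n ∧ ∃ c, a = (1 + (i + 1) * b) * c

instance (f g : (ℕ → M) → M) [hf : ArF f] [hg : ArF g] : Ar fun e => InCode (f e) (g e) := by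
  have : Ar fun e : ℕ → M => InCode (e 0) (e 1) := by unfold InCode; infer_instance
  exact this.comp₂ f g

theorem dvd_of_dvd_add_right {p x y : M} (h : p ∣ x + y) (hx : p ∣ x) : p ∣ y := by
  obtain ⟨k, rfl⟩ := hx
  obtain ⟨l, hl⟩ := h
  rcases le_total k l with ⟨d, rfl⟩ | ⟨d, rfl⟩
  · exact ⟨d, add_left_cancel (hl.trans (mul_add p k d))⟩
  · rw [mul_add, add_assoc] at hl
    have : p * d + y = 0 := add_left_cancel (hl.trans (add_zero _).symm)
    rw [eq_zero_of_add_eq_zero' this]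
    exact dvd_zero p

theorem exists_common_multiple (n : M) :
    ∃ b : M, 0 < b ∧ ∀ i, i < n → ∃ c, b = (i + 1) * c := by
  refine induct (fun n => ∃ b : M, 0 < b ∧ ∀ i, i < n → ∃ c, b = (i + 1) * c)
    ⟨1, one_pos, fun i hi => (not_lt_zero' i hi).elim⟩ ?_ n
  rintro n ⟨b, hb, h⟩
  refine ⟨b * (n + 1), mul_pos hb (by positivity), fun i hi => ?_⟩
  rcases (lt_succ_iff' _ _).1 hi with hi | rfl
  · obtain ⟨c, rfl⟩ := h i hi
    exact ⟨c * (n + 1), mul_assoc _ _ _⟩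
  · exact ⟨b, mul_comm _ _⟩

/-- The moduli `1 + (i + 1) b` and `1 + (k + 1) b` are coprime, since a suitable combination of
them is `|i - k|`, a divisor of `b`. -/
theorem dvd_of_dvd_mul_modulus {n b i k a : M} (hb : ∀ j, j < n → ∃ c, b = (j + 1) * c)
    (hi : i < n) (hk : k < n) (hik : i ≠ k)
    (h : 1 + (i + 1) * b ∣ a * (1 + (k + 1) * b)) : 1 + (i + 1) * b ∣ a := by
  have key : ∀ d, d < n → 1 + (i + 1) * b ∣ a * (d + 1) → 1 + (i + 1) * b ∣ a := by
    intro d hd h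
    obtain ⟨c, hc⟩ := hb d hd
    refine dvd_of_dvd_add_right (x := a * (d + 1) * (c * (i + 1))) ?_ (h.mul_right _)
    exact ⟨a, by rw [hc]; ring⟩
  rcases lt_or_gt_of_ne hik with hlt | hlt
  · obtain ⟨d, rfl⟩ := (lt_iff_exists_add_succ _ _).1 hlt
    refine key d (lt_of_le_of_lt ⟨i + 1, by ring⟩ hk) ?_
    refine dvd_of_dvd_add_right (x := a * (1 + (i + (d + 1) + 1) * b) * (i + 1)) ?_ (h.mul_right _)
    exact ⟨a * (i + (d + 1) + 1), by ring⟩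
  · obtain ⟨d, rfl⟩ := (lt_iff_exists_add_succ _ _).1 hlt
    refine key d (lt_of_le_of_lt ⟨k + 1, by ring⟩ hi) ?_
    refine dvd_of_dvd_add_right (x := a * (k + 1) * (1 + (k + (d + 1) + 1) * b)) ?_
      (dvd_mul_left _ _)
    convert h.mul_right (k + (d + 1) + 1) using 1
    ring

/-- Every bounded set of the model is coded by a number. -/
theorem exists_code (X : Set M) [IsSet X] (n : M) (hX : ∀ i ∈ X, i < n) :
    ∃ w, ∀ i, InCode i w ↔ i ∈ X := by
  obtain ⟨b, hb0, hb⟩ := exists_common_multiple n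
  have key : ∀ k : M, ∃ a, ∀ i, i < n → ((∃ c, a = (1 + (i + 1) * b) * c) ↔ i < k ∧ i ∈ X) := by
    refine induct (fun k : M => ∃ a, ∀ i, i < n →
      ((∃ c, a = (1 + (i + 1) * b) * c) ↔ i < k ∧ i ∈ X)) ?_ ?_
    · refine ⟨1, fun i _ => iff_of_false ?_ fun h => not_lt_zero' i h.1⟩
      rintro ⟨c, hc⟩
      have hc0 : c ≠ 0 := by rintro rfl; simp at hc
      have h₁ : (1 : M) < 1 + (i + 1) * b := lt_add_of_pos_right _ (by positivity)
      have h₂ : 1 + (i + 1) * b ≤ (1 + (i + 1) * b) * c :=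
        le_mul_of_one_le_right zero_le (by
          rcases eq_zero_or_succ c with rfl | ⟨c, rfl⟩
          · exact (hc0 rfl).elim
          · exact le_add_self)
      exact (h₁.trans_le h₂).ne hc
    · rintro k ⟨a, ha⟩
      by_cases hk : k ∈ X
      · refine ⟨a * (1 + (k + 1) * b), fun i hi => ?_⟩
        rw [lt_succ_iff']
        by_cases hik : i = k
        · subst hik
          exact iff_of_true ⟨a, mul_comm _ _⟩ ⟨.inr rfl, hk⟩
        · simp only [hik, or_false]
          rw [← ha i hi]
          refine ⟨fun h => dvd_of_dvd_mul_modulus hb hi (hX k hk) hik h, ?_⟩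
          rintro ⟨c, rfl⟩
          exact ⟨_, mul_assoc _ _ _⟩
      · refine ⟨a, fun i hi => ?_⟩
        rw [ha i hi, lt_succ_iff']
        refine ⟨fun h => ⟨.inl h.1, h.2⟩, fun ⟨h, h'⟩ => ⟨h.resolve_right ?_, h'⟩⟩
        rintro rfl
        exact hk h'
  obtain ⟨a, ha⟩ := key n
  refine ⟨opair (opair a b) n, fun i => ?_⟩
  constructor
  · rintro ⟨a', b', n', h, hi, hc⟩
    simp only [opair_inj] at h
    obtain ⟨⟨rfl, rfl⟩, rfl⟩ := h
    exact ((ha i hi).1 hc).2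
  · intro hi
    exact ⟨a, b, n, rfl, hX i hi, (ha i (hX i hi)).2 ⟨hX i hi, hi⟩⟩

theorem exists_code_empty : ∃ w : M, ∀ i, ¬ InCode i w := by
  have : IsSet (∅ : Set M) := isSet_setOf fun _ => False
  obtain ⟨w, hw⟩ := exists_code (∅ : Set M) 0 (by simp)
  exact ⟨w, fun i => by simp [hw]⟩

theorem exists_code_bound (w : M) : ∃ n, ∀ i, InCode i w → i < n := by
  by_cases h : ∃ a b n, w = opair (opair a b) n
  · obtain ⟨a, b, n, rfl⟩ := h
    refine ⟨n, ?_⟩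
    rintro i ⟨a', b', n', h, hi, -⟩
    simp only [opair_inj] at h
    rwa [h.2]
  · exact ⟨0, fun i ⟨a, b, n, hw, _⟩ => (h ⟨a, b, n, hw⟩).elim⟩

theorem exists_code_insert (w p : M) : ∃ w', ∀ i, InCode i w' ↔ InCode i w ∨ i = p := by
  obtain ⟨n, hn⟩ := exists_code_bound w
  have := isSet_setOf fun i => InCode i w ∨ i = p
  refine exists_code {i | InCode i w ∨ i = p} (n + (p + 1)) ?_
  rintro i (hi | rfl)
  · exact (hn i hi).trans_le le_self_add
  · exact (lt_add_one_iff'.2 le_rfl).trans_le le_add_self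

/-! ### Arithmetical dependent choice for finite sets -/

section Union

variable (P : M → Prop) (R : M → M → Prop)

/-- `w'` codes an extension of `w` that satisfies the `s`-th requirement. -/
def IsExt (s w w' : M) : Prop := (∀ i, InCode i w → InCode i w') ∧ P w' ∧ R s w'

/-- `w'` is the least such extension. -/
def IsLeastExt (s w w' : M) : Prop := IsExt P R s w w' ∧ ∀ v, v < w' → ¬ IsExt P R s w v

/-- `t` codes a finite set of pairs `(i, u)`, each of which is `(0, w₀)` or is obtained from another
pair of the set by passing to the least extension. -/
def IsHistory (w₀ t : M) : Prop :=
  ∀ i u, InCode (opair i u) t → i = 0 ∧ u = w₀ ∨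
    ∃ j v, i = j + 1 ∧ InCode (opair j v) t ∧ IsLeastExt P R j v u

/-- `u` is the `i`-th term of the sequence of least extensions that starts with `w₀`. -/
def IsTerm (w₀ i u : M) : Prop := ∃ t, IsHistory P R w₀ t ∧ InCode (opair i u) t

variable [hP : Ar fun e : ℕ → M => P (e 0)] [hR : Ar fun e : ℕ → M => R (e 0) (e 1)]

instance IsExt.ar (f g h : (ℕ → M) → M) [ArF f] [ArF g] [ArF h] :
    Ar fun e => IsExt P R (f e) (g e) (h e) := by
  have h₁ : Ar fun e : ℕ → M => P (e 2) :=
    hP.comp₂ (R := fun x _ => P x) (fun e => e 2) fun e => e 2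
  have h₂ : Ar fun e : ℕ → M => R (e 0) (e 2) := hR.comp₂ (fun e => e 0) fun e => e 2
  have : Ar fun e : ℕ → M => IsExt P R (e 0) (e 1) (e 2) := by unfold IsExt; infer_instance
  exact this.comp₃ f g h

instance IsLeastExt.ar (f g h : (ℕ → M) → M) [ArF f] [ArF g] [ArF h] :
    Ar fun e => IsLeastExt P R (f e) (g e) (h e) := by
  have : Ar fun e : ℕ → M => IsLeastExt P R (e 0) (e 1) (e 2) := by
    unfold IsLeastExt; infer_instance
  exact this.comp₃ f g h

instance IsTerm.ar (w₀ : M) (f g : (ℕ → M) → M) [ArF f] [ArF g] :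
    Ar fun e => IsTerm P R w₀ (f e) (g e) := by
  have : Ar fun e : ℕ → M => IsTerm P R w₀ (e 0) (e 1) := by
    unfold IsTerm IsHistory; infer_instance
  exact this.comp₂ f g

variable {P R} {w₀ : M}

omit hP hR in
theorem IsLeastExt.unique {s w u u' : M} (h : IsLeastExt P R s w u) (h' : IsLeastExt P R s w u') :
    u = u' := by
  rcases lt_trichotomy u u' with hlt | heq | hlt
  · exact (h'.2 u hlt h.1).elim
  · exact heq
  · exact (h.2 u' hlt h'.1).elim

omit hP hR in
theorem IsTerm.of_zero {u : M} (h : IsTerm P R w₀ 0 u) : u = w₀ := by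
  obtain ⟨t, ht, htu⟩ := h
  rcases ht _ _ htu with ⟨-, h⟩ | ⟨j, _, hj, -⟩
  · exact h
  · exact (succ_ne_zero' j hj.symm).elim

omit hP hR in
theorem IsTerm.of_succ {i u : M} (h : IsTerm P R w₀ (i + 1) u) :
    ∃ v, IsTerm P R w₀ i v ∧ IsLeastExt P R i v u := by
  obtain ⟨t, ht, htu⟩ := h
  rcases ht _ _ htu with ⟨h, -⟩ | ⟨j, v, hj, hv, hl⟩
  · exact (succ_ne_zero' i h).elim
  · obtain rfl := succ_inj' hj
    exact ⟨v, ⟨t, ht, hv⟩, hl⟩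

theorem IsTerm.unique {i u u' : M} (h : IsTerm P R w₀ i u) (h' : IsTerm P R w₀ i u') : u = u' := by
  refine induct (fun i => ∀ u u', IsTerm P R w₀ i u → IsTerm P R w₀ i u' → u = u') ?_ ?_ i u u' h h'
  · intro u u' h h'
    rw [h.of_zero, h'.of_zero]
  · intro i ih u u' h h'
    obtain ⟨v, hv, hu⟩ := h.of_succ
    obtain ⟨v', hv', hu'⟩ := h'.of_succ
    obtain rfl := ih v v' hv hv'
    exact hu.unique hu'

theorem IsTerm.exists (hw₀ : P w₀) (step : ∀ s w, P w → ∃ w', IsExt P R s w w') (i : M) :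
    ∃ u, P u ∧ IsTerm P R w₀ i u := by
  refine induct (fun i => ∃ u, P u ∧ IsTerm P R w₀ i u) ?_ ?_ i
  · obtain ⟨w, hw⟩ := exists_code_empty (M := M)
    obtain ⟨t, ht⟩ := exists_code_insert w (opair 0 w₀)
    refine ⟨w₀, hw₀, t, fun i u h => .inl ?_, (ht _).2 (.inr rfl)⟩
    exact opair_inj.1 (((ht _).1 h).resolve_left (hw _))
  · rintro i ⟨u, hu, t, ht, htu⟩
    obtain ⟨v, hv⟩ : ∃ v, IsLeastExt P R i u v := exists_least _ (step i u hu)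
    obtain ⟨t', ht'⟩ := exists_code_insert t (opair (i + 1) v)
    refine ⟨v, hv.1.2.1, t', fun j x h => ?_, (ht' _).2 (.inr rfl)⟩
    rcases (ht' _).1 h with h | h
    · refine (ht j x h).imp_right ?_
      rintro ⟨k, y, hk, hy, hl⟩
      exact ⟨k, y, hk, (ht' _).2 (.inl hy), hl⟩
    · obtain ⟨rfl, rfl⟩ := opair_inj.1 h
      exact .inr ⟨i, u, rfl, (ht' _).2 (.inl htu), hv⟩

theorem IsTerm.mono {i d u v x : M} (h : IsTerm P R w₀ i u) (h' : IsTerm P R w₀ (i + d) v)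
    (hx : InCode x u) : InCode x v := by
  refine induct (fun d => ∀ v, IsTerm P R w₀ (i + d) v → InCode x v) ?_ ?_ d v h'
  · intro v hv
    rw [add_zero] at hv
    rwa [← h.unique hv]
  · intro d ih v hv
    rw [← add_assoc] at hv
    obtain ⟨v', hv', hl⟩ := hv.of_succ
    exact hl.1.1 x (ih v' hv')

/-- Finite sets with the property `P` that can always be extended to meet one more of the
requirements `R s` have a chain of extensions that meets all of them. Its union `H` is a set of the
model. -/
theorem exists_union (hw₀ : P w₀) (step : ∀ s w, P w → ∃ w', IsExt P R s w w') :
    ∃ H : Set M, IsSet H ∧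
      (∀ x ∈ H, ∀ y ∈ H, ∃ w, P w ∧ InCode x w ∧ InCode y w ∧ ∀ i, InCode i w → i ∈ H) ∧
      ∀ s, ∃ w, R s w ∧ ∀ i, InCode i w → i ∈ H := by
  have hPt : ∀ i u, IsTerm P R w₀ i u → P u := fun i u h => by
    obtain ⟨v, hv, hv'⟩ := IsTerm.exists hw₀ step i
    rwa [h.unique hv']
  have key : ∀ i d u v x y, IsTerm P R w₀ i u → IsTerm P R w₀ (i + d) v → InCode x u →
      InCode y v → P v ∧ InCode x v ∧ InCode y v ∧
        ∀ z, InCode z v → z ∈ {x | ∃ i u, IsTerm P R w₀ i u ∧ InCode x u} :=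
    fun i d u v x y hu hv hx hy => ⟨hPt _ _ hv, hu.mono hv hx, hy, fun z hz => ⟨_, v, hv, hz⟩⟩
  refine ⟨{x | ∃ i u, IsTerm P R w₀ i u ∧ InCode x u}, isSet_setOf _, ?_, fun s => ?_⟩
  · rintro x ⟨i, u, hu, hx⟩ y ⟨j, v, hv, hy⟩
    rcases le_total i j with ⟨d, rfl⟩ | ⟨d, rfl⟩
    · exact ⟨v, key _ _ _ _ _ _ hu hv hx hy⟩
    · obtain ⟨h₁, h₂, h₃, h₄⟩ := key _ _ _ _ _ _ hv hu hy hx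
      exact ⟨u, h₁, h₃, h₂, h₄⟩
  · obtain ⟨u, -, hu⟩ := IsTerm.exists hw₀ step (s + 1)
    obtain ⟨v, -, hl⟩ := hu.of_succ
    exact ⟨u, hl.1.2.2, fun i hi => ⟨s + 1, u, hu, hi⟩⟩

end Union

/-! ### The order of the rationals -/

/-- `q` is the least code of a fraction of its value. -/
def IsRat (q : M) : Prop :=
  ∃ m n k, q = opair (opair m n) k ∧ ∀ m' n' k',
    m * (k' + 1) + n' * (k + 1) = m' * (k + 1) + n * (k' + 1) → ¬ opair (opair m' n') k' < q

/-- The order `<_ℚ` on codes of fractions. -/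
def RLt (p q : M) : Prop :=
  ∃ m n k m' n' k', p = opair (opair m n) k ∧ q = opair (opair m' n') k' ∧
    m * (k' + 1) + n' * (k + 1) < m' * (k + 1) + n * (k' + 1)

/-- The reflexive closure of `<_ℚ`. -/
def RLe (p q : M) : Prop := p = q ∨ RLt p q

/-- `(c, d)` is a nonempty interval of rationals contained in `(a, b)`. -/
def SubI (a b c d : M) : Prop := IsRat c ∧ IsRat d ∧ RLe a c ∧ RLt c d ∧ RLe d b

section Ar

variable (f g h k : (ℕ → M) → M) [hf : ArF f] [hg : ArF g] [ArF h] [ArF k]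

instance IsRat.ar : Ar fun e => IsRat (f e) := by
  have : Ar fun e : ℕ → M => IsRat (e 0) := by unfold IsRat; infer_instance
  exact this.comp f

instance RLt.ar : Ar fun e => RLt (f e) (g e) := by
  have : Ar fun e : ℕ → M => RLt (e 0) (e 1) := by unfold RLt; infer_instance
  exact this.comp₂ f g

instance SubI.ar : Ar fun e => SubI (f e) (g e) (h e) (k e) := by
  unfold SubI RLe; infer_instance

end Ar

/-- Transitivity of the comparison of fractions by cross-multiplication. -/
theorem cross_trans {m n k m' n' k' m'' n'' k'' : M}
    (h₁ : m * (k' + 1) + n' * (k + 1) < m' * (k + 1) + n * (k' + 1))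
    (h₂ : m' * (k'' + 1) + n'' * (k' + 1) ≤ m'' * (k' + 1) + n' * (k'' + 1)) :
    m * (k'' + 1) + n'' * (k + 1) < m'' * (k + 1) + n * (k'' + 1) := by
  have h₃ := mul_lt_mul_of_pos_right h₁ (show 0 < k'' + 1 by positivity)
  have h₄ := mul_le_mul_of_nonneg_right h₂ (show 0 ≤ k + 1 from zero_le)
  refine lt_of_mul_lt_mul_right (a := k' + 1) ?_ zero_le
  refine lt_of_add_lt_add_right (a := n' * (k + 1) * (k'' + 1) + m' * (k'' + 1) * (k + 1)) ?_
  refine lt_of_eq_of_lt ?_ (lt_of_lt_of_eq (add_lt_add_of_lt_of_le h₃ h₄) ?_) <;> ring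

theorem cross_trans' {m n k m' n' k' m'' n'' k'' : M}
    (h₁ : m * (k' + 1) + n' * (k + 1) ≤ m' * (k + 1) + n * (k' + 1))
    (h₂ : m' * (k'' + 1) + n'' * (k' + 1) < m'' * (k' + 1) + n' * (k'' + 1)) :
    m * (k'' + 1) + n'' * (k + 1) < m'' * (k + 1) + n * (k'' + 1) := by
  have h₃ := mul_le_mul_of_nonneg_right h₁ (show 0 ≤ k'' + 1 from zero_le)
  have h₄ := mul_lt_mul_of_pos_right h₂ (show 0 < k + 1 by positivity)
  refine lt_of_mul_lt_mul_right (a := k' + 1) ?_ zero_le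
  refine lt_of_add_lt_add_right (a := n' * (k + 1) * (k'' + 1) + m' * (k'' + 1) * (k + 1)) ?_
  refine lt_of_eq_of_lt ?_ (lt_of_lt_of_eq (add_lt_add_of_le_of_lt h₃ h₄) ?_) <;> ring

theorem rLt_frac {m n k m' n' k' : M} :
    RLt (opair (opair m n) k) (opair (opair m' n') k') ↔
      m * (k' + 1) + n' * (k + 1) < m' * (k + 1) + n * (k' + 1) := by
  refine ⟨?_, fun h => ⟨_, _, _, _, _, _, rfl, rfl, h⟩⟩
  rintro ⟨_, _, _, _, _, _, h₁, h₂, h⟩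
  simp only [opair_inj] at h₁ h₂
  obtain ⟨⟨rfl, rfl⟩, rfl⟩ := h₁
  obtain ⟨⟨rfl, rfl⟩, rfl⟩ := h₂
  exact h

theorem RLt.irrefl (p : M) : ¬ RLt p p := by
  rintro ⟨m, n, k, m', n', k', rfl, h₂, h⟩
  simp only [opair_inj] at h₂
  obtain ⟨⟨rfl, rfl⟩, rfl⟩ := h₂
  exact lt_irrefl _ h

theorem RLt.trans {p q r : M} (h₁ : RLt p q) (h₂ : RLt q r) : RLt p r := by
  obtain ⟨m, n, k, m', n', k', rfl, rfl, h₁⟩ := h₁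
  obtain ⟨_, _, _, m'', n'', k'', h, rfl, h₂⟩ := h₂
  simp only [opair_inj] at h
  obtain ⟨⟨rfl, rfl⟩, rfl⟩ := h
  exact rLt_frac.2 (cross_trans h₁ h₂.le)

theorem RLe.trans_rLt {p q r : M} (h₁ : RLe p q) (h₂ : RLt q r) : RLt p r := by
  rcases h₁ with rfl | h₁
  · exact h₂
  · exact h₁.trans h₂

theorem RLt.trans_rLe {p q r : M} (h₁ : RLt p q) (h₂ : RLe q r) : RLt p r := by
  rcases h₂ with rfl | h₂
  · exact h₁
  · exact h₁.trans h₂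

theorem RLe.trans {p q r : M} (h₁ : RLe p q) (h₂ : RLe q r) : RLe p r := by
  rcases h₁ with rfl | h₁
  · exact h₂
  · exact .inr (h₁.trans_rLe h₂)

/-- Every fraction has a code that is a rational. -/
theorem exists_isRat_eq (m n k : M) :
    ∃ m' n' k', IsRat (opair (opair m' n') k') ∧
      m * (k' + 1) + n' * (k + 1) = m' * (k + 1) + n * (k' + 1) := by
  obtain ⟨q, ⟨m', n', k', rfl, h⟩, hq⟩ := exists_least
    (fun q => ∃ m' n' k', q = opair (opair m' n') k' ∧
      m * (k' + 1) + n' * (k + 1) = m' * (k + 1) + n * (k' + 1)) ⟨_, m, n, k, rfl, rfl⟩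
  refine ⟨m', n', k', ⟨m', n', k', rfl, fun m'' n'' k'' h' hlt => ?_⟩, h⟩
  refine hq _ hlt ⟨m'', n'', k'', rfl, ?_⟩
  refine mul_right_cancel₀ (b := k' + 1) (by positivity) ?_
  refine add_right_cancel (b := n' * (k + 1) * (k'' + 1) + m' * (k'' + 1) * (k + 1)) ?_
  have := congrArg₂ (· + ·) (congrArg (· * (k'' + 1)) h) (congrArg (· * (k + 1)) h')
  convert this using 1 <;> ring

/-- The order of the rationals is dense. -/
theorem RLt.exists_between {p q : M} (h : RLt p q) : ∃ r, IsRat r ∧ RLt p r ∧ RLt r q := by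
  obtain ⟨m, n, k, m', n', k', rfl, rfl, h⟩ := h
  -- the midpoint of the two fractions
  obtain ⟨m'', n'', k'', hr, he⟩ := exists_isRat_eq (m * (k' + 1) + m' * (k + 1))
    (n * (k' + 1) + n' * (k + 1)) (2 * (k * k' + k + k') + 1)
  refine ⟨_, hr, rLt_frac.2 (cross_trans ?_ he.le), rLt_frac.2 (cross_trans' he.ge ?_)⟩
  · refine lt_of_eq_of_lt ?_ (lt_of_lt_of_eq (add_lt_add_left (mul_lt_mul_of_pos_right h
      (show 0 < k + 1 by positivity)) (m * (k' + 1) * (k + 1) + n * (k' + 1) * (k + 1))) ?_) <;>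
      ring
  · refine lt_of_eq_of_lt ?_ (lt_of_lt_of_eq (add_lt_add_left (mul_lt_mul_of_pos_right h
      (show 0 < k' + 1 by positivity)) (m' * (k' + 1) * (k + 1) + n' * (k' + 1) * (k + 1))) ?_) <;>
      ring

theorem exists_isRat_rLt : ∃ p q : M, IsRat p ∧ IsRat q ∧ RLt p q := by
  have h : RLt (opair (opair (0 : M) 0) 0) (opair (opair 1 0) 0) := rLt_frac.2 (by simp)
  obtain ⟨p, hp, -, hp'⟩ := h.exists_between
  obtain ⟨q, hq, hpq, -⟩ := hp'.exists_between
  exact ⟨p, q, hp, hq, hpq⟩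

theorem SubI.trans {a b c d c' d' : M} (h : SubI a b c d) (h' : SubI c d c' d') :
    SubI a b c' d' :=
  ⟨h'.1, h'.2.1, h.2.2.1.trans h'.2.2.1, h'.2.2.2.1, h'.2.2.2.2.trans h.2.2.2.2⟩

theorem SubI.refl {a b : M} (ha : IsRat a) (hb : IsRat b) (hab : RLt a b) : SubI a b a b :=
  ⟨ha, hb, .inl rfl, hab, .inl rfl⟩

/-- Every interval has a subinterval that omits a given point. -/
theorem SubI.exists_omit {a b c d : M} (h : SubI a b c d) (x : M) :
    ∃ c' d', SubI c d c' d' ∧ ¬ (RLt c' x ∧ RLt x d') := by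
  obtain ⟨hc, hd, -, hcd, -⟩ := h
  obtain ⟨z, hz, hcz, hzd⟩ := hcd.exists_between
  by_cases hx : RLt x z
  · exact ⟨z, d, ⟨hz, hd, .inr hcz, hzd, .inl rfl⟩, fun h => RLt.irrefl _ (hx.trans h.1)⟩
  · exact ⟨c, z, ⟨hc, hz, .inl rfl, hcz, .inr hzd⟩, fun h => hx h.2⟩

/-- A finite union of nowhere dense sets is nowhere dense. -/
theorem exists_subI_avoiding (N : M → M → Prop) [hN : Ar fun e : ℕ → M => N (e 0) (e 1)] {a b : M}
    (h : ∀ i c d, SubI a b c d → ∃ c' d', SubI c d c' d' ∧ ∀ y, N i y → RLt c' y → ¬ RLt y d')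
    (n : M) : ∀ c d, SubI a b c d → ∃ c' d', SubI c d c' d' ∧
      ∀ i, i < n → ∀ y, N i y → RLt c' y → ¬ RLt y d' := by
  have hN' (f g : (ℕ → M) → M) [ArF f] [ArF g] : Ar fun e => N (f e) (g e) := hN.comp₂ f g
  refine induct (fun n => ∀ c d, SubI a b c d → ∃ c' d', SubI c d c' d' ∧
      ∀ i, i < n → ∀ y, N i y → RLt c' y → ¬ RLt y d') ?_ ?_ n
  · exact fun c d hcd => ⟨c, d, .refl hcd.1 hcd.2.1 hcd.2.2.2.1,
      fun i hi => (not_lt_zero' i hi).elim⟩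
  · intro n ih c d hcd
    obtain ⟨c₁, d₁, h₁, h₁'⟩ := ih c d hcd
    obtain ⟨c₂, d₂, h₂, h₂'⟩ := h n c₁ d₁ (hcd.trans h₁)
    refine ⟨c₂, d₂, h₁.trans h₂, fun i hi y hy hc hd => ?_⟩
    rcases (lt_succ_iff' _ _).1 hi with hi | rfl
    · exact h₁' i hi y hy (h₂.2.2.1.trans_rLt hc) (hd.trans_rLe h₂.2.2.2.2)
    · exact h₂' y hy hc hd

/-! ### The Erdős–Rado theorem in a model -/

section ErdosRado

variable (F : Set M)

/-- The pair `{x, y}` has color `0`. -/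
def Col (x y : M) : Prop :=
  x < y ∧ opair (opair x y) 0 ∈ F ∨ y < x ∧ opair (opair y x) 0 ∈ F

/-- `y` is a rational that forms a pair of color `0` with each element of the finite set `w`. -/
def Red (w y : M) : Prop := IsRat y ∧ ∀ i, InCode i w → Col F i y

variable {F}

theorem Col.symm {x y : M} (h : Col F x y) : Col F y x := Or.symm h

theorem Col.irrefl (x : M) : ¬ Col F x x := fun h => h.elim (fun h => lt_irrefl _ h.1)
  fun h => lt_irrefl _ h.1

variable (F) [IsSet F]

instance Col.ar (f g : (ℕ → M) → M) [ArF f] [ArF g] : Ar fun e => Col F (f e) (g e) := by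
  unfold Col; infer_instance

instance Red.ar (f g : (ℕ → M) → M) [ArF f] [ArF g] : Ar fun e => Red F (f e) (g e) := by
  have : Ar fun e : ℕ → M => Red F (e 0) (e 1) := by unfold Red; infer_instance
  exact this.comp₂ f g

/-- If `X` is dense in an interval in which, for almost every `x ∈ X`, the elements of `X` joined
to `x` by color `0` are nowhere dense, then a dense set without pairs of color `0` is built by
adding points to the intervals one after the other. -/
theorem exists_dense_of_nowhere_dense (X : M → Prop) [hX : Ar fun e : ℕ → M => X (e 0)] {a b s : M}
    (ha : IsRat a) (hb : IsRat b) (hab : RLt a b)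
    (hdense : ∀ c d, SubI a b c d → ∃ y, X y ∧ RLt c y ∧ RLt y d) (hXr : ∀ x, X x → IsRat x)
    (hnd : ∀ x, X x → RLt a x → RLt x b → s < x → ∀ c d, SubI a b c d →
      ∃ c' d', SubI c d c' d' ∧ ∀ y, X y ∧ Col F x y → RLt c' y → ¬ RLt y d') :
    ∃ H : Set M, IsSet H ∧ (∀ x ∈ H, X x) ∧ (∀ x ∈ H, ∀ y ∈ H, ¬ Col F x y) ∧
      (∃ x ∈ H, ∃ y ∈ H, RLt x y) ∧
      ∀ x ∈ H, ∀ y ∈ H, RLt x y → ∃ z ∈ H, RLt x z ∧ RLt z y := by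
  have hX' (f : (ℕ → M) → M) [ArF f] : Ar fun e => X (f e) := hX.comp₂ (R := fun x _ => X x) f f
  obtain ⟨w₀, hw₀⟩ := exists_code_empty (M := M)
  obtain ⟨H, hH, hP, hR⟩ := exists_union (w₀ := w₀)
    (P := fun v => (∀ x, InCode x v → X x ∧ RLt a x ∧ RLt x b ∧ s < x) ∧
      ∀ x y, InCode x v → InCode y v → ¬ Col F x y)
    (R := fun t v => ∀ x y, t = opair x y → SubI a b x y →
      ∃ z, InCode z v ∧ RLt x z ∧ RLt z y)
    ⟨fun x hx => (hw₀ x hx).elim, fun x _ hx => (hw₀ x hx).elim⟩ (by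
      rintro t v ⟨hv₁, hv₂⟩
      by_cases ht : ∃ x y, t = opair x y ∧ SubI a b x y
      · obtain ⟨x, y, rfl, hxy⟩ := ht
        obtain ⟨n, hn⟩ := exists_code_bound v
        -- an interval inside `(x, y)` that avoids the points up to `s` and everything joined to the
        -- elements of `v` by color `0`
        obtain ⟨c, d, hcd, hav⟩ := exists_subI_avoiding
          (fun i z => InCode i v ∧ X z ∧ Col F i z ∨ z = i) (a := a) (b := b) (fun i c d hcd => by
            obtain ⟨c₁, d₁, h₁, h₁'⟩ : ∃ c' d', SubI c d c' d' ∧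
                ∀ y, InCode i v ∧ X y ∧ Col F i y → RLt c' y → ¬ RLt y d' := by
              by_cases hi : InCode i v
              · obtain ⟨hi₁, hi₂, hi₃, hi₄⟩ := hv₁ i hi
                obtain ⟨c', d', h, h'⟩ := hnd i hi₁ hi₂ hi₃ hi₄ c d hcd
                exact ⟨c', d', h, fun y hy => h' y hy.2⟩
              · exact ⟨c, d, .refl hcd.1 hcd.2.1 hcd.2.2.2.1, fun y hy => (hi hy.1).elim⟩
            obtain ⟨c₂, d₂, h₂, h₂'⟩ := h₁.exists_omit i
            refine ⟨c₂, d₂, h₁.trans h₂, ?_⟩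
            rintro z (hz | rfl) hcz hzd
            · exact h₁' z hz (h₂.2.2.1.trans_rLt hcz) (hzd.trans_rLe h₂.2.2.2.2)
            · exact h₂' ⟨hcz, hzd⟩) (n + (s + 1)) x y hxy
        obtain ⟨z, hz, hcz, hzd⟩ := hdense c d (hxy.trans hcd)
        have hsz : s < z := by
          by_contra! hzs
          exact hav z ((lt_add_one_iff'.2 hzs).trans_le le_add_self) z (.inr rfl) hcz hzd
        have hcol : ∀ i, InCode i v → ¬ Col F i z := fun i hi h =>
          hav i ((hn i hi).trans_le le_self_add) z (.inl ⟨hi, hz, h⟩) hcz hzd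
        have hxz := hcd.2.2.1.trans_rLt hcz
        have hzy := hzd.trans_rLe hcd.2.2.2.2
        obtain ⟨v', hv'⟩ := exists_code_insert v z
        refine ⟨v', fun i hi => (hv' i).2 (.inl hi), ⟨fun i hi => ?_, fun i j hi hj => ?_⟩, ?_⟩
        · rcases (hv' i).1 hi with hi | rfl
          · exact hv₁ i hi
          · exact ⟨hz, hxy.2.2.1.trans_rLt hxz, hzy.trans_rLe hxy.2.2.2.2, hsz⟩
        · rcases (hv' i).1 hi with hi | rfl <;> rcases (hv' j).1 hj with hj | rfl
          · exact hv₂ i j hi hj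
          · exact hcol i hi
          · exact fun h => hcol j hj h.symm
          · exact Col.irrefl _
        · intro x' y' h _
          obtain ⟨rfl, rfl⟩ := opair_inj.1 h
          exact ⟨z, (hv' z).2 (.inr rfl), hxz, hzy⟩
      · exact ⟨v, fun _ h => h, ⟨hv₁, hv₂⟩, fun x y h h' => (ht ⟨x, y, h, h'⟩).elim⟩)
  have hmem : ∀ x ∈ H, X x ∧ RLt a x ∧ RLt x b := fun x hx => by
    obtain ⟨w, hw, hxw, -⟩ := hP x hx x hx
    exact ⟨(hw.1 x hxw).1, (hw.1 x hxw).2.1, (hw.1 x hxw).2.2.1⟩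
  have hbet : ∀ x y, SubI a b x y → ∃ z ∈ H, RLt x z ∧ RLt z y := fun x y hxy => by
    obtain ⟨w, hw, hwH⟩ := hR (opair x y)
    obtain ⟨z, hz, hz'⟩ := hw x y rfl hxy
    exact ⟨z, hwH z hz, hz'⟩
  refine ⟨H, hH, fun x hx => (hmem x hx).1, fun x hx y hy => ?_, ?_, fun x hx y hy hxy => ?_⟩
  · obtain ⟨w, hw, hxw, hyw, -⟩ := hP x hx y hy
    exact hw.2 x y hxw hyw
  · obtain ⟨y, hy, hay, hyb⟩ := hbet a b (.refl ha hb hab)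
    obtain ⟨x, hx, -, hxy⟩ := hbet a y ⟨ha, hXr y (hmem y hy).1, .inl rfl, hay, .inr hyb⟩
    exact ⟨x, hx, y, hy, hxy⟩
  · exact hbet x y ⟨hXr x (hmem x hx).1, hXr y (hmem y hy).1, .inr (hmem x hx).2.1, hxy,
      .inr (hmem y hy).2.2⟩

/-- If a finite set `w` that leaves `Red F w` dense somewhere can always be extended by a large
element of `Red F w`, then there is an infinite set with all pairs of color `0`. -/
theorem exists_infinite_of_extend
    (hext : ∀ w a b s, IsRat a → IsRat b → RLt a b →
      (∀ c d, SubI a b c d → ∃ y, Red F w y ∧ RLt c y ∧ RLt y d) →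
      ∃ x, Red F w x ∧ s < x ∧ ∃ c d, SubI a b c d ∧
        ∀ c' d', SubI c d c' d' → ∃ y, (Red F w y ∧ Col F x y) ∧ RLt c' y ∧ RLt y d') :
    ∃ H : Set M, IsSet H ∧ (∀ x ∈ H, IsRat x) ∧ (∀ x ∈ H, ∀ y ∈ H, x < y → Col F x y) ∧
      ∀ n, ∃ x ∈ H, n < x := by
  obtain ⟨w₀, hw₀⟩ := exists_code_empty (M := M)
  have h₀ : ∃ a b, IsRat a ∧ IsRat b ∧ RLt a b ∧
      ∀ c d, SubI a b c d → ∃ y, Red F w₀ y ∧ RLt c y ∧ RLt y d := by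
    obtain ⟨a, b, ha, hb, hab⟩ := exists_isRat_rLt (M := M)
    refine ⟨a, b, ha, hb, hab, fun c d hcd => ?_⟩
    obtain ⟨y, hy, hy'⟩ := hcd.2.2.2.1.exists_between
    exact ⟨y, ⟨hy, fun i hi => (hw₀ i hi).elim⟩, hy'⟩
  obtain ⟨H, hH, hP, hR⟩ := exists_union (w₀ := w₀)
    (P := fun v => (∀ x, InCode x v → IsRat x) ∧
      (∀ x y, InCode x v → InCode y v → ¬ x = y → Col F x y) ∧
      ∃ a b, IsRat a ∧ IsRat b ∧ RLt a b ∧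
        ∀ c d, SubI a b c d → ∃ y, Red F v y ∧ RLt c y ∧ RLt y d)
    (R := fun t v => ∃ x, InCode x v ∧ t < x) ⟨fun x hx => (hw₀ x hx).elim,
      fun x _ hx => (hw₀ x hx).elim, h₀⟩ (by
      rintro s v ⟨hv₁, hv₂, a, b, ha, hb, hab, hd⟩
      obtain ⟨x, hx, hsx, c, d, hcd, hd'⟩ := hext v a b s ha hb hab hd
      obtain ⟨v', hv'⟩ := exists_code_insert v x
      refine ⟨v', fun i hi => (hv' i).2 (.inl hi), ⟨fun i hi => ?_, fun i j hi hj hij => ?_,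
        c, d, hcd.1, hcd.2.1, hcd.2.2.2.1, fun c' d' h => ?_⟩, x, (hv' x).2 (.inr rfl), hsx⟩
      · rcases (hv' i).1 hi with hi | rfl
        · exact hv₁ i hi
        · exact hx.1
      · rcases (hv' i).1 hi with hi | rfl <;> rcases (hv' j).1 hj with hj | rfl
        · exact hv₂ i j hi hj hij
        · exact hx.2 i hi
        · exact (hx.2 j hj).symm
        · exact (hij rfl).elim
      · obtain ⟨y, ⟨hy₁, hy₂⟩, hy⟩ := hd' c' d' h
        refine ⟨y, ⟨hy₁.1, fun i hi => ?_⟩, hy⟩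
        rcases (hv' i).1 hi with hi | rfl
        · exact hy₁.2 i hi
        · exact hy₂)
  refine ⟨H, hH, fun x hx => ?_, fun x hx y hy hxy => ?_, fun n => ?_⟩
  · obtain ⟨w, hw, hxw, -⟩ := hP x hx x hx
    exact hw.1 x hxw
  · obtain ⟨w, hw, hxw, hyw, -⟩ := hP x hx y hy
    exact hw.2.1 x y hxw hyw hxy.ne
  · obtain ⟨w, ⟨x, hx, hnx⟩, hwH⟩ := hR n
    exact ⟨x, hwH x hx, hnx⟩

/-- The Erdős–Rado theorem, by the two constructions above. -/
theorem erdosRado :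
    (∃ H : Set M, IsSet H ∧ (∀ x ∈ H, IsRat x) ∧ (∀ x ∈ H, ∀ y ∈ H, x < y → Col F x y) ∧
      ∀ n, ∃ x ∈ H, n < x) ∨
    ∃ H : Set M, IsSet H ∧ (∀ x ∈ H, IsRat x) ∧ (∀ x ∈ H, ∀ y ∈ H, ¬ Col F x y) ∧
      (∃ x ∈ H, ∃ y ∈ H, RLt x y) ∧
      ∀ x ∈ H, ∀ y ∈ H, RLt x y → ∃ z ∈ H, RLt x z ∧ RLt z y := by
  by_cases hext : ∀ w a b s, IsRat a → IsRat b → RLt a b →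
      (∀ c d, SubI a b c d → ∃ y, Red F w y ∧ RLt c y ∧ RLt y d) →
      ∃ x, Red F w x ∧ s < x ∧ ∃ c d, SubI a b c d ∧
        ∀ c' d', SubI c d c' d' → ∃ y, (Red F w y ∧ Col F x y) ∧ RLt c' y ∧ RLt y d'
  · exact .inl (exists_infinite_of_extend F hext)
  · push Not at hext
    obtain ⟨w, a, b, s, ha, hb, hab, hd, h⟩ := hext
    obtain ⟨H, h₁, h₂, h₃⟩ := exists_dense_of_nowhere_dense F (Red F w) ha hb hab hd
      (fun x hx => hx.1) fun x hx _ _ hsx => h x hx hsx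
    exact .inr ⟨H, h₁, fun x hx => (h₂ x hx).1, h₃⟩

end ErdosRado

/-! ### Translation of the statement -/

section Translation

variable (e : ℕ → M) (E : ℕ → L2Structure.sets (M := M))

theorem le_opair_left (x y : M) : x ≤ opair x y := le_add_self

theorem le_opair_right (x y : M) : y ≤ opair x y := by
  rcases eq_zero_or_succ y with rfl | ⟨y, rfl⟩
  · exact zero_le
  · exact ⟨x * x + 2 * x * y + 3 * x + y * y + y, by rw [opair]; ring⟩

theorem eval_pair (s t : Tm) : (pair s t).eval e = opair (s.eval e) (t.eval e) := rfl

theorem eval_frac (m n k : Tm) :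
    (frac m n k).eval e = opair (opair (m.eval e) (n.eval e)) (k.eval e) := rfl

theorem sat_eq (s t : Tm) : (Fm.eq s t).Sat e E ↔ s.eval e = t.eval e := Iff.rfl

theorem sat_lt (s t : Tm) : (Fm.lt s t).Sat e E ↔ s.eval e < t.eval e := Iff.rfl

theorem sat_mem (t : Tm) (X : ℕ) : (Fm.mem t X).Sat e E ↔ t.eval e ∈ (E X).1 := Iff.rfl

theorem sat_isRat (q : Tm) : (isRat q).Sat e E ↔ IsRat (q.eval e) := by
  simp only [isRat, Fm.sat_bex, Fm.sat_ball, Fm.sat_and, Fm.sat_imp, Fm.sat_neg, sat_eq, sat_lt,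
    fracEq, cross, eval_frac, Tm.eval, Tm.eval_lift, scons, lt_add_one_iff']
  constructor
  · rintro ⟨m, -, n, -, k, -, hq, h⟩
    refine ⟨m, n, k, hq, fun m' n' k' he hlt => ?_⟩
    refine h m' ?_ n' ?_ k' ?_ he hlt
    · exact (le_opair_left _ _).trans ((le_opair_left _ _).trans hlt.le)
    · exact (le_opair_right _ _).trans ((le_opair_left _ _).trans hlt.le)
    · exact (le_opair_right _ _).trans hlt.le
  · rintro ⟨m, n, k, hq, h⟩
    refine ⟨m, ?_, n, ?_, k, ?_, hq, fun m' _ n' _ k' _ => h m' n' k'⟩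
    · exact ((le_opair_left _ _).trans (le_opair_left _ _)).trans hq.ge
    · exact ((le_opair_right _ _).trans (le_opair_left _ _)).trans hq.ge
    · exact (le_opair_right _ _).trans hq.ge

theorem sat_ratLt (p q : Tm) : (ratLt p q).Sat e E ↔ RLt (p.eval e) (q.eval e) := by
  simp only [ratLt, Fm.sat_bex, Fm.sat_and, sat_eq, sat_lt,
    fracLt, cross, eval_frac, Tm.eval, Tm.eval_lift, scons, lt_add_one_iff']
  constructor
  · rintro ⟨m, -, n, -, k, -, m', -, n', -, k', -, hp, hq, h⟩
    exact ⟨m, n, k, m', n', k', hp, hq, h⟩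
  · rintro ⟨m, n, k, m', n', k', hp, hq, h⟩
    refine ⟨m, ?_, n, ?_, k, ?_, m', ?_, n', ?_, k', ?_, hp, hq, h⟩
    · exact ((le_opair_left _ _).trans (le_opair_left _ _)).trans hp.ge
    · exact ((le_opair_right _ _).trans (le_opair_left _ _)).trans hp.ge
    · exact (le_opair_right _ _).trans hp.ge
    · exact ((le_opair_left _ _).trans (le_opair_left _ _)).trans hq.ge
    · exact ((le_opair_right _ _).trans (le_opair_left _ _)).trans hq.ge
    · exact (le_opair_right _ _).trans hq.ge

theorem sat_ER22 : ER22.Sat e E := by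
  simp only [ER22, isColoring, isRatPair, isColor, isHomogeneous, subRat, isInfinite, isDense,
    Fm.sat_allS, Fm.sat_imp, Fm.sat_and, Fm.sat_or, Fm.sat_exS, Fm.sat_all, Fm.sat_ex, sat_isRat,
    sat_ratLt, sat_eq, sat_lt, sat_mem, eval_pair, Tm.eval, Tm.eval_lift, scons]
  rintro F ⟨-, hF⟩
  -- a pair that does not have color `0` has color `1`
  have hcol : ∀ x y : M, IsRat x → IsRat y → x < y → ¬ Col F.1 x y →
      opair (opair x y) 1 ∈ F.1 := by
    intro x y hx hy hxy hc
    obtain ⟨i, hi, hmem, -⟩ := hF x y ⟨hx, hy, hxy⟩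
    rw [lt_add_one_iff'] at hi
    rcases eq_zero_or_succ i with rfl | ⟨i, rfl⟩
    · exact (hc (.inl ⟨hxy, hmem⟩)).elim
    · rcases eq_zero_or_succ i with rfl | ⟨i, rfl⟩
      · rwa [zero_add] at hmem
      · exact (((lt_iff_exists_add_succ _ _).2 ⟨i, by ring⟩).not_ge hi).elim
  have : IsSet F.1 := ⟨F.2⟩
  rcases erdosRado F.1 with ⟨H, hH, hrat, h₁, h₂⟩ | ⟨H, hH, hrat, h₁, h₂, h₃⟩
  · refine .inl ⟨⟨H, hH.mem_sets⟩, ⟨hrat, fun x y hx hy hxy => ?_⟩, h₂⟩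
    rcases h₁ x hx y hy hxy with h | h
    · exact h.2
    · exact (lt_asymm hxy h.1).elim
  · refine .inr ⟨⟨H, hH.mem_sets⟩,
      ⟨hrat, fun x y hx hy hxy => hcol x y (hrat x hx) (hrat y hy) hxy (h₁ x hx y hy)⟩, ?_, ?_⟩
    · obtain ⟨x, hx, y, hy, hxy⟩ := h₂
      exact ⟨x, y, hx, hy, hxy⟩
    · intro x y hx hy hxy
      exact h₃ x hx y hy hxy

end Translation

end SOA

theorem mainTheorem4 : SOA.Proves SOA.ACA0 SOA.ER22 :=
  SOA.proves_of_forall_sat fun M _ hM e E =>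
    letI : SOA.ACAModel M := { sat := hM, sets_nonempty := ⟨E 0⟩ }
    SOA.sat_ER22 e E
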